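/- Let $n \ge 1$ and let $(X,\omega,J,\Omega)$ be a Calabi--Yau manifold of complex dimension $n$: $(X,J)$ is a complex manifold, $\omega$ is a Kähler form with Kähler metric $g=\omega(\cdot,J\cdot)$, and $\Omega$ is a holomorphic $n$-form of constant length, normalised by $$(-1)^{\frac{n(n-1)}{2}}\Big(\frac{\sqrt{-1}}{2}\Big)^n\,\Omega\wedge\overline{\Omega}=\frac{1}{n!}\,\omega^n$$ (so that $g$ is Ricci-flat). Let $L$ be a compact oriented $n$-dimensional smooth manifold with smooth boundary, let $C_1,\dots,C_d$ be the connected components of $\partial L$, and let $\Lambda_1,\dots,\Lambda_d\subset X$ be pairwise disjoint embedded Lagrangian submanifolds. Let $$f:[0,1]\times L\to X,\qquad f_t:=f(t,\cdot),$$ be a smooth map such that for each $t\in[0,1]$: * $f_t$ is a special Lagrangian immersion, i.e. an immersion with $f_t^*\omega=0$ and $f_t^*\operatorname{Im}\Omega=0$; * $f_t$ satisfies the boundary conditions $\Lambda_1,\dots,\Lambda_d$, i.e. $f_t(C_i)\subset\Lambda_i$ and $df_t(T_pL)\not\subset T_{f_t(p)}\Lambda_i$ for all $p\in C_i$ and $i=1,\dots,d$.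 Assume that $L$ carries the orientation for which $f_0^*\operatorname{Re}\Omega$ is a positive $n$-form (the calibrated orientation). For $t\in[0,1]$ let $g_t=f_t^*g$ be the pullback metric, let $\star_t$ be the Hodge star of $g_t$ and this orientation, determined by $\beta\wedge\star_t\alpha=g_t(\beta,\alpha)\operatorname{Vol}_{g_t}$, and let $d^{*}=(-1)^{n(k+1)+1}\star_t d\,\star_t$ on $k$-forms and $\Delta=dd^*+d^*d$. With $i_V\alpha=\alpha(V,\cdot,\dots,\cdot)$, put $$\theta_t:=f_t^*\big(i_{\frac{d f_t}{dt}}\omega\big)\in A^1(L),\qquad \phi_t:=f_t^*\big(i_{\frac{d f_t}{dt}}\operatorname{Im}\Omega\big)\in A^{n-1}(L).$$ Then for each $t\in[0,1]$: 1. $\theta_t$ and $\phi_t$ are smooth closed differential forms on $L$, and the pullback of $\theta_t$ to $\partial L$ vanishes. 2. $\star_t\theta_t=-\phi_t$; equivalently, $\phi_t$ is the Hodge star of $\theta_t$ for $g_t$ and the opposite orientation of $L$, the one for which $f_0^*\operatorname{Re}\Omega$ is negative. 3. $\theta_t$ and $\phi_t$ are harmonic fields for $g_t$: $d\theta_t=0$,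 $d^*\theta_t=0$, $\Delta\theta_t=0$, and likewise for $\phi_t$. 4. $\theta_t$ satisfies the Dirichlet boundary condition and $\phi_t$ satisfies the Neumann boundary condition: at each $p\in\partial L$, if $P$ is the $g_t$-orthogonal projection $T_pL\to T_p\partial L$ and $\alpha_{tan}(v_1,\dots,v_k)=\alpha(Pv_1,\dots,Pv_k)$, then $(\theta_t)_{tan}=0$ and $\phi_t=(\phi_t)_{tan}$. -/

import Mathlib

open Set Function
open scoped Manifold ContDiff Topology

noncomputable section

/-! ### Differential forms on manifolds with corners -/

namespace SLag

section Forms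

variable {𝕜 : Type*} [NontriviallyNormedField 𝕜]
  {E : Type*} [NormedAddCommGroup E] [NormedSpace 𝕜 E]
  {H : Type*} [TopologicalSpace H] (I : ModelWithCorners 𝕜 E H)
  {M : Type*} [TopologicalSpace M] [ChartedSpace H M]
  {E' : Type*} [NormedAddCommGroup E'] [NormedSpace 𝕜 E']
  {H' : Type*} [TopologicalSpace H'] (I' : ModelWithCorners 𝕜 E' H')
  {M' : Type*} [TopologicalSpace M'] [ChartedSpace H' M']
  {F : Type*} [NormedAddCommGroup F] [NormedSpace 𝕜 F]

/-- A (not necessarily continuous) `F`-valued differential `k`-form on `M`: an alternating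
`k`-linear map on every tangent space. -/
abbrev DForm (M : Type*) [TopologicalSpace M] [ChartedSpace H M]
    (F : Type*) [NormedAddCommGroup F] [NormedSpace 𝕜 F] (k : ℕ) : Type _ :=
  ∀ p : M, TangentSpace I p [⋀^Fin k]→L[𝕜] F

/-- The expression of a `k`-form in the preferred chart at `x`: its pullback to the model space
under the inverse of that chart. -/
def chartForm {k : ℕ} (α : DForm I M F k) (x : M) (y : E) : E [⋀^Fin k]→L[𝕜] F :=
  (α ((extChartAt I x).symm y)).compContinuousLinearMap
    (mfderivWithin 𝓘(𝕜, E) I (extChartAt I x).symm (range I) y)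

/-- A form is smooth if all its chart expressions are (for `𝕜 = ℂ`: a form of type `(k, 0)`
is holomorphic). -/
def IsSmoothForm {k : ℕ} (α : DForm I M F k) : Prop :=
  ∀ x : M, ContDiffOn 𝕜 ∞ (chartForm I α x) (extChartAt I x).target

/-- The exterior derivative of a differential form, computed at `x` in the preferred chart at `x`
(for a smooth form the result does not depend on the chart). -/
def dExt {k : ℕ} (α : DForm I M F k) : DForm I M F (k + 1) := fun x =>
  (extDerivWithin (chartForm I α x) (range I) (extChartAt I x x)).compContinuousLinearMap
    (mfderiv I 𝓘(𝕜, E) (extChartAt I x) x)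

/-- The pullback `f^* α` of a form. -/
def pullbackForm {k : ℕ} (f : M → M') (α : DForm I' M' F k) : DForm I M F k := fun p =>
  (α (f p)).compContinuousLinearMap (mfderiv I I' f p)

variable {I} in
/-- The interior product `i_v α = α(v, ·, …, ·)` of a form at a point with a tangent vector. -/
def interiorProd {k : ℕ} {p : M} (v : TangentSpace I p)
    (α : TangentSpace I p [⋀^Fin (k + 1)]→L[𝕜] F) : TangentSpace I p [⋀^Fin k]→L[𝕜] F :=
  ContinuousAlternatingMap.curryLeft (E := E) α v

variable {I} in
/-- The iterated interior product `α(w₀, …, w_{k-1}, ·, …, ·)`. -/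
def iteratedInteriorProd {l : ℕ} {p : M} : (k : ℕ) → (Fin k → TangentSpace I p) →
    (TangentSpace I p [⋀^Fin (l + k)]→L[𝕜] F) → TangentSpace I p [⋀^Fin l]→L[𝕜] F
  | 0, _, α => α
  | k + 1, w, α => iteratedInteriorProd k (fun i => w i.succ) (interiorProd (w 0) α)

end Forms

/-- Transport of an alternating map along an equality of degrees. -/
def castDegree {V : Type*} [AddCommGroup V] [Module ℝ V] [TopologicalSpace V] {a b : ℕ}
    (h : a = b) (α : V [⋀^Fin a]→L[ℝ] ℝ) : V [⋀^Fin b]→L[ℝ] ℝ :=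
  { α.toAlternatingMap.domDomCongr (finCongr h) with
    cont := α.cont.comp (continuous_pi fun _ => continuous_apply _) }

/-! ### Hodge theory of an oriented Riemannian manifold with boundary

A metric is given by its values `g p v w` on tangent vectors, and an orientation of an
`n`-manifold by a nowhere-vanishing `n`-form `μ`: a basis `e` of `T_p M` is positively oriented if
`0 < μ_p(e)`. -/

section Hodge

variable {E : Type*} [NormedAddCommGroup E] [NormedSpace ℝ E]
  {H : Type*} [TopologicalSpace H] {I : ModelWithCorners ℝ E H}
  {M : Type*} [TopologicalSpace M] [ChartedSpace H M] {n : ℕ}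
  (g : ∀ p : M, TangentSpace I p → TangentSpace I p → ℝ) (μ : DForm I M ℝ n)

/-- `e` is a positively oriented `g`-orthonormal frame of `T_p M`. -/
def IsOrientedFrame (p : M) (e : Fin n → TangentSpace I p) : Prop :=
  (∀ i j, g p (e i) (e j) = if i = j then 1 else 0) ∧ 0 < μ p e

open Classical in
/-- A choice of a positively oriented orthonormal frame at `p`. -/
def orientedFrame (p : M) : Fin n → TangentSpace I p :=
  if h : ∃ e, IsOrientedFrame g μ p e then h.choose else 0

/-- The Riemannian volume form: the `n`-form with value `1` on positively oriented orthonormal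
frames. -/
def volForm : DForm I M ℝ n := fun p => (μ p (orientedFrame g μ p))⁻¹ • μ p

/-- The Hodge star `⋆ : Λᵏ → Λˡ`, `l + k = n`. For a positively oriented orthonormal frame `e`,
`(⋆α)(v₁, …, v_l) = 1/k! ∑_{i₁, …, i_k} α(e_{i₁}, …, e_{i_k}) Vol(e_{i₁}, …, e_{i_k}, v₁, …, v_l)`,
which is independent of the frame and is the form with `β ∧ ⋆α = g(β, α) Vol` for all
`k`-forms `β`. -/
def hodgeStar {k l : ℕ} (h : l + k = n) (α : DForm I M ℝ k) : DForm I M ℝ l := fun p =>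
  ((k.factorial : ℝ)⁻¹) • ∑ i : Fin k → Fin n,
    α p (fun a => orientedFrame g μ p (i a)) •
      iteratedInteriorProd k (fun a => orientedFrame g μ p (i a))
        (castDegree h.symm (volForm g μ p))

open Classical in
/-- The codifferential `d^* = (-1)^{n(q+1)+1} ⋆ d ⋆` on `q`-forms, for `q = k + 1`. -/
def codiff (k : ℕ) (α : DForm I M ℝ (k + 1)) : DForm I M ℝ k :=
  if h : k + 1 ≤ n then
    (-1 : ℝ) ^ (n * (k + 2) + 1) •
      hodgeStar g μ (k := n - (k + 1) + 1) (l := k) (by omega)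
        (dExt I (hodgeStar g μ (k := k + 1) (l := n - (k + 1)) (by omega) α))
  else 0

/-- A `k`-form is co-closed if `d^* α = 0` (no condition on functions). -/
def IsCoclosed : (k : ℕ) → DForm I M ℝ k → Prop
  | 0, _ => True
  | k + 1, α => codiff g μ k α = 0

/-- The Laplace–Beltrami operator `Δ = d d^* + d^* d` on `k`-forms. -/
def laplacian : (k : ℕ) → DForm I M ℝ k → DForm I M ℝ k
  | 0, α => codiff g μ 0 (dExt I α)
  | k + 1, α => dExt I (codiff g μ k α) + codiff g μ (k + 1) (dExt I α)

/-- A harmonic field: a smooth harmonic form that is both closed and co-closed. -/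
structure IsHarmonicField {k : ℕ} (α : DForm I M ℝ k) : Prop where
  smooth : IsSmoothForm I α
  harmonic : laplacian g μ k α = 0
  closed : dExt I α = 0
  coclosed : IsCoclosed g μ k α

end Hodge

section Boundary

variable {n : ℕ} [NeZero n] {L : Type*} [TopologicalSpace L] [ChartedSpace (EuclideanHalfSpace n) L]

/-- The tangent space `T_p ∂L ⊆ T_p L` at a boundary point `p`: the vectors whose component
normal to the boundary of the half-space vanishes in a chart. -/
def boundaryTangent (p : L) : Set (TangentSpace (𝓡∂ n) p) :=
  {v | (show EuclideanSpace ℝ (Fin n) from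
    mfderiv (𝓡∂ n) 𝓘(ℝ, EuclideanSpace ℝ (Fin n)) (extChartAt (𝓡∂ n) p) p v) 0 = 0}

/-- The form pulls back to zero on `∂L`. -/
def VanishesOnBoundary {k : ℕ} (α : DForm (𝓡∂ n) L ℝ k) : Prop :=
  ∀ p ∈ (𝓡∂ n).boundary L, ∀ v : Fin k → TangentSpace (𝓡∂ n) p,
    (∀ i, v i ∈ boundaryTangent p) → α p v = 0

variable (g : ∀ p : L, TangentSpace (𝓡∂ n) p → TangentSpace (𝓡∂ n) p → ℝ)

/-- `u` is the `g`-orthogonal projection of `v ∈ T_p L` to `T_p ∂L`. -/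
def IsBoundaryProj (p : L) (v u : TangentSpace (𝓡∂ n) p) : Prop :=
  u ∈ boundaryTangent p ∧ ∀ w ∈ boundaryTangent p, g p (v - u) w = 0

/-- Dirichlet boundary condition: the tangential component `α_tan`, which is
`α_tan(v₁, …, v_k) = α(Pv₁, …, Pv_k)` for the orthogonal projection `P : T_p L → T_p ∂L`,
vanishes at all boundary points. -/
def IsDirichlet {k : ℕ} (α : DForm (𝓡∂ n) L ℝ k) : Prop :=
  ∀ p ∈ (𝓡∂ n).boundary L, ∀ v u : Fin k → TangentSpace (𝓡∂ n) p,
    (∀ i, IsBoundaryProj g p (v i) (u i)) → α p u = 0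

/-- Neumann boundary condition: the normal component `α_norm = α - α_tan` vanishes at all
boundary points. -/
def IsNeumann {k : ℕ} (α : DForm (𝓡∂ n) L ℝ k) : Prop :=
  ∀ p ∈ (𝓡∂ n).boundary L, ∀ v u : Fin k → TangentSpace (𝓡∂ n) p,
    (∀ i, IsBoundaryProj g p (v i) (u i)) → α p v - α p u = 0

/-- `C₁, …, C_d` are the boundary components of `L`: the connected components of `∂L`, each
listed once. -/
structure IsBoundaryComponents {d : ℕ} (C : Fin d → Set L) : Prop where
  injective : Injective C
  range_eq : range C =
    {S | ∃ p ∈ (𝓡∂ n).boundary L, S = connectedComponentIn ((𝓡∂ n).boundary L) p}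

end Boundary

/-! ### Calabi–Yau manifolds -/

section Wedge

variable {V : Type*} [AddCommGroup V] [Module ℝ V]

/-- The wedge product of complex-valued real-multilinear alternating forms,
`(α ∧ β)(v) = ∑ sign(σ) α(v_{σ(1)}, …, v_{σ(a)}) β(v_{σ(a+1)}, …, v_{σ(a+b)})`, the sum being over
`(a, b)`-shuffles. -/
def wedge {a b : ℕ} (α : V [⋀^Fin a]→ₗ[ℝ] ℂ) (β : V [⋀^Fin b]→ₗ[ℝ] ℂ) :
    V [⋀^Fin (a + b)]→ₗ[ℝ] ℂ :=
  ((LinearMap.mul' ℝ ℂ).compAlternatingMap (α.domCoprod β)).domDomCongr finSumFinEquiv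

/-- The wedge power `βⁿ = β ∧ ⋯ ∧ β` of a `2`-form. -/
def wedgePow (β : V [⋀^Fin 2]→ₗ[ℝ] ℂ) : (n : ℕ) → V [⋀^Fin (2 * n)]→ₗ[ℝ] ℂ
  | 0 => AlternatingMap.constOfIsEmpty ℝ V (Fin 0) 1
  | n + 1 => wedge (wedgePow β n) β

end Wedge

section CalabiYau

variable {E : Type*} [NormedAddCommGroup E] [NormedSpace ℂ E]
  {X : Type*} [TopologicalSpace X] [ChartedSpace E X]

/-- The complex structure `J` of a complex manifold on its real tangent spaces:
multiplication by `i` in the holomorphic chart. -/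
def complexStructure (x : X) : TangentSpace 𝓘(ℝ, E) x →L[ℝ] TangentSpace 𝓘(ℝ, E) x :=
  (Complex.I • ContinuousLinearMap.id ℝ E : E →L[ℝ] E)

/-- The complex-valued real differential form underlying a form of type `(k, 0)`, that is, a
family of complex-multilinear alternating maps on the holomorphic tangent spaces. -/
def realForm {k : ℕ} (Ω : DForm 𝓘(ℂ, E) X ℂ k) : DForm 𝓘(ℝ, E) X ℂ k := fun x =>
  show E [⋀^Fin k]→L[ℝ] ℂ from
    ContinuousAlternatingMap.restrictScalars ℝ (show E [⋀^Fin k]→L[ℂ] ℂ from Ω x)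

/-- `Re Ω` -/
def reForm {k : ℕ} (Ω : DForm 𝓘(ℂ, E) X ℂ k) : DForm 𝓘(ℝ, E) X ℝ k := fun x =>
  Complex.reCLM.compContinuousAlternatingMap (realForm Ω x)

/-- `Im Ω` -/
def imForm {k : ℕ} (Ω : DForm 𝓘(ℂ, E) X ℂ k) : DForm 𝓘(ℝ, E) X ℝ k := fun x =>
  Complex.imCLM.compContinuousAlternatingMap (realForm Ω x)

variable (E X) in
/-- A Calabi–Yau structure on a complex manifold `X` of complex dimension `n`: a Kähler form `ω`
and a holomorphic `n`-form `Ω` of constant length, normalised by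
`(-1)^{n(n-1)/2} (i/2)ⁿ Ω ∧ Ω̄ = ωⁿ / n!`. (Ricci-flatness of the Kähler metric is a consequence
of this equation.) -/
structure CalabiYau (n : ℕ) where
  /-- the Kähler form `ω` -/
  kahler : DForm 𝓘(ℝ, E) X ℝ 2
  /-- the holomorphic volume form `Ω` -/
  vol : DForm 𝓘(ℂ, E) X ℂ n
  dim_eq : Module.finrank ℂ E = n
  smooth_kahler : IsSmoothForm 𝓘(ℝ, E) kahler
  closed_kahler : dExt 𝓘(ℝ, E) kahler = 0
  invariant_kahler : ∀ (x : X) (v w : TangentSpace 𝓘(ℝ, E) x),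
    kahler x ![complexStructure x v, complexStructure x w] = kahler x ![v, w]
  positive_kahler : ∀ (x : X) (v : TangentSpace 𝓘(ℝ, E) x), v ≠ 0 →
    0 < kahler x ![v, complexStructure x v]
  holomorphic_vol : IsSmoothForm 𝓘(ℂ, E) vol
  volume_eq : ∀ (x : X) (v : Fin (2 * n) → TangentSpace 𝓘(ℝ, E) x),
    (-1 : ℂ) ^ (n * (n - 1) / 2) * (Complex.I / 2) ^ n *
        wedge (realForm vol x).toAlternatingMap
          (Complex.conjCLE.toLinearMap.compAlternatingMap (realForm vol x).toAlternatingMap)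
          (fun i => v (Fin.cast (by omega) i)) =
      ((n.factorial : ℂ)⁻¹) *
        wedgePow (Complex.ofRealCLM.toLinearMap.compAlternatingMap (kahler x).toAlternatingMap) n v

variable {n : ℕ} (Y : CalabiYau E X n)

/-- The Kähler metric `g = ω(·, J ·)`. -/
def CalabiYau.metric (x : X) (v w : TangentSpace 𝓘(ℝ, E) x) : ℝ :=
  Y.kahler x ![v, complexStructure x w]

/-- `ι : N → X` exhibits the `n`-manifold `N` (without boundary) as an embedded Lagrangian
submanifold of `X`. -/
structure CalabiYau.IsEmbeddedLagrangian {N : Type*} [TopologicalSpace N]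
    [ChartedSpace (EuclideanSpace ℝ (Fin n)) N] (ι : N → X) : Prop where
  embedding : Manifold.IsSmoothEmbedding (𝓡 n) 𝓘(ℝ, E) ∞ ι
  lagrangian : pullbackForm (𝓡 n) 𝓘(ℝ, E) ι Y.kahler = 0

section Immersion

variable [NeZero n] {L : Type*} [TopologicalSpace L] [ChartedSpace (EuclideanHalfSpace n) L]

/-- The pullback `f^* g` of the Kähler metric. -/
def CalabiYau.pullbackMetric (f : L → X) (p : L) (v w : TangentSpace (𝓡∂ n) p) : ℝ :=
  Y.metric (f p) (mfderiv (𝓡∂ n) 𝓘(ℝ, E) f p v) (mfderiv (𝓡∂ n) 𝓘(ℝ, E) f p w)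

/-- `f : L → X` is a special Lagrangian immersion: a smooth map with injective differentials,
`f^* ω = 0` and `f^* Im Ω = 0`. -/
structure CalabiYau.IsSpecialLagrangianImmersion (f : L → X) : Prop where
  smooth : ContMDiff (𝓡∂ n) 𝓘(ℝ, E) ∞ f
  injective : ∀ p, Injective (mfderiv (𝓡∂ n) 𝓘(ℝ, E) f p)
  lagrangian : pullbackForm (𝓡∂ n) 𝓘(ℝ, E) f Y.kahler = 0
  special : pullbackForm (𝓡∂ n) 𝓘(ℝ, E) f (imForm Y.vol) = 0

end Immersion

/-- The map `f : L → X` has boundary conditions `Λ₁, …, Λ_d`, where `Λᵢ` is the image of the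
embedding `ι i : Λ i → X` and `C i` is the `i`-th boundary component: `f(Cᵢ) ⊆ Λᵢ`, and
`df(T_p L) ⊄ T_{f(p)} Λᵢ` for `p ∈ Cᵢ`. (When `ι i y = f p`, the tangent spaces of `X` at these two
points are the same model space `E`, in the same chart.) -/
structure HasBoundaryConditions {n : ℕ} [NeZero n] {L : Type*} [TopologicalSpace L]
    [ChartedSpace (EuclideanHalfSpace n) L] {d : ℕ} (C : Fin d → Set L)
    {Λ : Fin d → Type*} [∀ i, TopologicalSpace (Λ i)]
    [∀ i, ChartedSpace (EuclideanSpace ℝ (Fin n)) (Λ i)] (ι : ∀ i, Λ i → X) (f : L → X) :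
    Prop where
  maps : ∀ i, f '' C i ⊆ range (ι i)
  not_tangent : ∀ i, ∀ p ∈ C i, ∀ y : Λ i, ι i y = f p →
    ¬ (range (fun v : TangentSpace (𝓡∂ n) p => (mfderiv (𝓡∂ n) 𝓘(ℝ, E) f p v : E)) ⊆
        range (fun w : TangentSpace (𝓡 n) y => (mfderiv (𝓡 n) 𝓘(ℝ, E) (ι i) y w : E)))

variable {L : Type*}

/-- The velocity `∂_t f (t, p) ∈ T_{f(t, p)} X` of a path `f_t`, `t ∈ [0, 1]` (one-sided at the
endpoints). -/
def velocity (f : ℝ → L → X) (t : ℝ) (p : L) : TangentSpace 𝓘(ℝ, E) (f t p) :=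
  mfderivWithin 𝓘(ℝ, ℝ) 𝓘(ℝ, E) (fun s => f s p) (Icc 0 1) t (1 : ℝ)

/-- For a `(k+1)`-form `α` on `X` and a path `f_t`, the `k`-form `f_t^* (i_{∂_t f} α)` on `L`. -/
def tangentForm {n : ℕ} [NeZero n] [TopologicalSpace L] [ChartedSpace (EuclideanHalfSpace n) L]
    {k : ℕ} (f : ℝ → L → X) (α : DForm 𝓘(ℝ, E) X ℝ (k + 1)) (t : ℝ) : DForm (𝓡∂ n) L ℝ k :=
  fun p => (interiorProd (velocity f t p) (α (f t p))).compContinuousLinearMap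
    (mfderiv (𝓡∂ n) 𝓘(ℝ, E) (f t) p)

end CalabiYau

end SLag

end

/-! Closedness. Let `F(t, p) = f_t(p)` on `[0,1] × L`, and let `α` be `ω` or `Im Ω`. Since `f_t^* α
= 0` on every time slice, `F^* α = dt ∧ τ_t` with `τ_t = f_t^*(i_{∂_t f} α)`. As `α` is closed, `0 =
d(F^* α) = -dt ∧ dτ_t`, so `dτ_t = 0` (`extDerivWithin_sliceContraction`, carried to manifolds by
`dExt_tangentForm`). The form `Im Ω` is closed because `Ω` is holomorphic of top degree
(`dExt_imForm`).

Duality. The image of `df_t` is a Lagrangian plane, so it and its image under `J` span the tangent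
space of `X`, and the velocity can be written `df u + J df w`. The tangential part `u` drops out of
both forms: `θ_t = -g_t(w, ·)` and `φ_t = i_w (f_t^* Re Ω)` (`exists_normal_component`). The
normalisation of `Ω` gives `|Ω| = 1` on unitary frames (`norm_apply_of_unitary`), so `f_t^* Re Ω` is
the volume form up to sign. The sign is constant in `t`, because a nonvanishing continuous function
on `[0,1]` does not change sign (`pullback_reForm_apply_pos`). Since the star of the 1-form dual to
`w` is `i_w Vol`, it follows that `⋆θ_t = -φ_t`. The star of `φ_t` is `±θ_t`, so closedness of each
form yields co-closedness of the other, and both terms of the Laplacian vanish.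

Boundary. At a point of `C_i` the velocity is tangent to `Λ_i`, and so is the image of every vector
tangent to `∂L`. As `ω` vanishes on `Λ_i`, `θ_t` vanishes on `∂L`
(`vanishesOnBoundary_tangentForm`). Equivalently `w` is normal to `∂L`, and `i_w Vol` is then
insensitive to normal components of its arguments (`apply_cons_eq_of_orthogonal`), which is the
Neumann condition. -/

noncomputable section

namespace SLag

/-! ### Wedge products of covectors as determinants -/

section WedgeDet

variable {V : Type*} [AddCommGroup V] [Module ℝ V]

/-- The alternating form `c · η₁ ∧ ⋯ ∧ η_k` of complex-valued covectors. -/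
def covectorWedge {ι : Type*} [Fintype ι] [DecidableEq ι] (c : ℂ) (η : ι → (V →ₗ[ℝ] ℂ)) :
    V [⋀^ι]→ₗ[ℝ] ℂ :=
  MultilinearMap.alternatization (c • (MultilinearMap.mkPiAlgebra ℝ ι ℂ).compLinearMap η)

theorem covectorWedge_apply {ι : Type*} [Fintype ι] [DecidableEq ι] (c : ℂ)
    (η : ι → (V →ₗ[ℝ] ℂ)) (v : ι → V) :
    covectorWedge c η v = c * (Matrix.of fun j i => η i (v j)).det := by
  rw [covectorWedge, MultilinearMap.alternatization_apply, Matrix.det_apply, Finset.mul_sum]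
  refine Finset.sum_congr rfl fun σ _ => ?_
  simp [Units.smul_def]
  ring

/-- The shuffle product of two alternatizations is the alternatization of the tensor product, which
leaves a single sum over permutations, that is, one determinant. -/
theorem wedge_covectorWedge {a b : ℕ} (c d : ℂ) (η : Fin a → (V →ₗ[ℝ] ℂ))
    (ζ : Fin b → (V →ₗ[ℝ] ℂ)) :
    wedge (covectorWedge c η) (covectorWedge d ζ) = covectorWedge (c * d) (Fin.append η ζ) := by
  ext v
  rw [covectorWedge_apply, ← Matrix.det_submatrix_equiv_self finSumFinEquiv, wedge, covectorWedge,
    covectorWedge, ← MultilinearMap.domCoprod_alternization, Matrix.det_apply, Finset.mul_sum]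
  simp only [AlternatingMap.domDomCongr_apply, LinearMap.compAlternatingMap_apply,
    MultilinearMap.alternatization_apply, map_sum]
  refine Finset.sum_congr rfl fun σ _ => ?_
  rw [Units.smul_def, map_zsmul, Units.smul_def]
  simp
  ring

theorem alternatingMap_sum_apply {ι κ N : Type*} [AddCommGroup N] [Module ℝ N] (s : Finset κ)
    (α : κ → V [⋀^ι]→ₗ[ℝ] N) (v : ι → V) : (∑ i ∈ s, α i) v = ∑ i ∈ s, α i v :=
  map_sum (⟨⟨fun β => β v, rfl⟩, fun _ _ => rfl⟩ : (V [⋀^ι]→ₗ[ℝ] N) →+ N) α s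

theorem wedge_sum_sum {a b : ℕ} {κ κ' : Type*} [Fintype κ] [Fintype κ']
    (α : κ → V [⋀^Fin a]→ₗ[ℝ] ℂ) (β : κ' → V [⋀^Fin b]→ₗ[ℝ] ℂ) :
    wedge (∑ i, α i) (∑ j, β j) = ∑ i, ∑ j, wedge (α i) (β j) := by
  have h (α : V [⋀^Fin a]→ₗ[ℝ] ℂ) (β : V [⋀^Fin b]→ₗ[ℝ] ℂ) :
      wedge α β = AlternatingMap.domDomCongrₗ ℝ finSumFinEquiv
        (LinearMap.compAlternatingMapₗ ℝ (LinearMap.mul' ℝ ℂ)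
          (AlternatingMap.domCoprod' (α ⊗ₜ β))) := rfl
  simp only [h, TensorProduct.sum_tmul, map_sum, TensorProduct.tmul_sum]
  exact Finset.sum_comm

/-- The covectors `η_{j₁}, ζ_{j₁}, …, η_{j_n}, ζ_{j_n}`. -/
def interleave {N n : ℕ} (η : Fin 2 → Fin N → (V →ₗ[ℝ] ℂ)) (j : Fin n → Fin N) :
    Fin (2 * n) → (V →ₗ[ℝ] ℂ) :=
  fun i => η ⟨i % 2, by omega⟩ (j ⟨i / 2, by omega⟩)

theorem wedgePow_sum {N : ℕ} (η : Fin 2 → Fin N → (V →ₗ[ℝ] ℂ)) (c : ℂ) (n : ℕ) :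
    wedgePow (∑ j, covectorWedge c (fun i => η i j)) n =
      ∑ j : Fin n → Fin N, covectorWedge (c ^ n) (interleave η j) := by
  induction n with
  | zero =>
    ext v
    simp [wedgePow, covectorWedge_apply]
  | succ n ih =>
    -- `wedgePow` multiplies the new factor on the right, so its index is appended last.
    rw [wedgePow, ih, wedge_sum_sum, ← (Fin.snocEquiv fun _ => Fin N).sum_comp,
      Fintype.sum_prod_type, Finset.sum_comm]
    refine Finset.sum_congr rfl fun j _ => Finset.sum_congr rfl fun k _ => ?_
    rw [wedge_covectorWedge, ← pow_succ]
    congr 1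
    funext i
    refine Fin.addCases (fun i => ?_) (fun i => ?_) i
    · have h : (i : ℕ) / 2 < n := Nat.div_lt_of_lt_mul i.2
      rw [Fin.append_left]
      simp [interleave, Fin.snoc, h]
    · rw [Fin.append_right]
      fin_cases i
      · simp [interleave, Fin.snoc]
      · have h : (2 * n + 1) % 2 = 1 := by omega
        have h' : ¬ (2 * n + 1) / 2 < n := by omega
        simp [interleave, Fin.snoc, h, h']

/-- The splitting of `Fin (2 * n)` into pairs of consecutive indices. -/
def pairEquiv (n : ℕ) : Fin (2 * n) ≃ Fin n × Fin 2 where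
  toFun i := (⟨i / 2, by omega⟩, ⟨i % 2, by omega⟩)
  invFun q := ⟨2 * q.1 + q.2, by omega⟩
  left_inv i := Fin.ext (by simp; omega)
  right_inv q := Prod.ext (Fin.ext (by simp; omega)) (Fin.ext (by simp; omega))

/-- Two-forms commute: permuting the pairs by `σ` permutes the `2 * n` covectors by two copies of
`σ`, of sign `sign(σ)² = 1`. -/
theorem covectorWedge_interleave_perm {n : ℕ} (η : Fin 2 → Fin n → (V →ₗ[ℝ] ℂ)) (c : ℂ)
    (σ : Equiv.Perm (Fin n)) :
    covectorWedge c (interleave η σ) = covectorWedge c (interleave η id) := by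
  ext v
  rw [covectorWedge_apply, covectorWedge_apply]
  congr 1
  set π : Equiv.Perm (Fin (2 * n)) :=
    (pairEquiv n).symm.permCongr (Equiv.prodCongrLeft fun _ : Fin 2 => σ) with hπ
  have hs : Equiv.Perm.sign π = 1 := by
    rw [hπ, Equiv.Perm.sign_permCongr, Equiv.Perm.sign_prodCongrLeft]
    simp
  have := Matrix.det_permute' π (Matrix.of fun j i => interleave η id i (v j))
  rw [hs] at this
  simp only [Units.val_one, Int.cast_one, one_mul] at this
  rw [← this]
  congr 1
  ext j i
  have h1 : (2 * (σ ⟨i / 2, by omega⟩ : ℕ) + i % 2) % 2 = i % 2 := by omega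
  have h2 : (2 * (σ ⟨i / 2, by omega⟩ : ℕ) + i % 2) / 2 = σ ⟨i / 2, by omega⟩ := by omega
  simp [interleave, hπ, pairEquiv, Equiv.permCongr_apply, h1, h2]

theorem covectorWedge_interleave_of_not_injective {n N : ℕ} (η : Fin 2 → Fin N → (V →ₗ[ℝ] ℂ))
    (c : ℂ) (j : Fin n → Fin N) (hj : ¬ Injective j) :
    covectorWedge c (interleave η j) = 0 := by
  ext v
  simp only [Injective, not_forall] at hj
  obtain ⟨a, b, hab, hne⟩ := hj
  rw [covectorWedge_apply, Matrix.det_zero_of_column_eq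
    (i := (pairEquiv n).symm (a, 0)) (j := (pairEquiv n).symm (b, 0))]
  · simp
  · simpa using hne
  · intro k
    simp [interleave, pairEquiv, hab]

/-- The injective self-maps of `Fin n` are its `n!` permutations. This produces the `n!` in `ωⁿ`. -/
theorem sum_eq_factorial_smul {n : ℕ} {A : Type*} [AddCommMonoid A]
    (F : (Fin n → Fin n) → A) (a : A)
    (h0 : ∀ j, ¬ Injective j → F j = 0) (h1 : ∀ σ : Equiv.Perm (Fin n), F σ = a) :
    ∑ j, F j = n.factorial • a := by
  have := Finset.sum_of_injOn (s := (Finset.univ : Finset (Equiv.Perm (Fin n))))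
    (t := Finset.univ) (f := fun _ => a) (g := F) (fun σ => (σ : Fin n → Fin n))
    (DFunLike.coe_injective.injOn) (fun _ _ => by simp) ?_ (fun σ _ => (h1 σ).symm)
  · rw [← this]
    simp [Fintype.card_perm]
  · intro j _ hj
    apply h0
    intro hinj
    exact hj ⟨Equiv.ofBijective j (Finite.injective_iff_bijective.1 hinj), by simp, rfl⟩

theorem wedgePow_sum_self {n : ℕ} (η : Fin 2 → Fin n → (V →ₗ[ℝ] ℂ)) (c : ℂ) :
    wedgePow (∑ j, covectorWedge c (fun i => η i j)) n =
      n.factorial • covectorWedge (c ^ n) (interleave η id) := by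
  rw [wedgePow_sum]
  exact sum_eq_factorial_smul _ _ (fun j hj => covectorWedge_interleave_of_not_injective _ _ _ hj)
    fun σ => covectorWedge_interleave_perm _ _ σ

/-- The permutation moving the even positions to the front. -/
def deinterleave (n : ℕ) : Equiv.Perm (Fin (2 * n)) :=
  (pairEquiv n).trans <| (Equiv.prodComm _ _).trans finProdFinEquiv

/-- Reordering covectors changes the determinant by a sign only. Norms suffice because only `|Ω|` on
a unitary frame is wanted, so the sign `(-1)^{n(n-1)/2}` never has to be matched. -/
theorem norm_covectorWedge_interleave {n : ℕ} (η : Fin 2 → Fin n → (V →ₗ[ℝ] ℂ)) (c : ℂ)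
    (v : Fin (2 * n) → V) :
    ‖covectorWedge c (interleave η id) v‖ =
      ‖covectorWedge c (Fin.append (η 0) (η 1)) (fun i => v (Fin.cast (by omega) i))‖ := by
  rw [covectorWedge_apply, covectorWedge_apply, norm_mul, norm_mul]
  congr 1
  have h := Matrix.det_permute' (deinterleave n)
    (Matrix.of fun j i : Fin (2 * n) =>
      Fin.append (η 0) (η 1) (Fin.cast (by omega) i) (v j))
  have h1 : (Matrix.of fun j i : Fin (2 * n) =>
      Fin.append (η 0) (η 1) (Fin.cast (by omega) i) (v j)).submatrix id (deinterleave n) =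
      Matrix.of fun j i => interleave η id i (v j) := by
    ext j i
    obtain ⟨⟨a, b⟩, rfl⟩ := (pairEquiv n).symm.surjective i
    have h2 : deinterleave n ((pairEquiv n).symm (a, b)) = finProdFinEquiv (b, a) := by
      simp [deinterleave]
    have h3 : interleave η id ((pairEquiv n).symm (a, b)) = η b a := by
      have h4 : (2 * (a : ℕ) + b) % 2 = b := by omega
      have h5 : (2 * (a : ℕ) + b) / 2 = a := by omega
      simp [interleave, pairEquiv, h4, h5]
    simp only [Matrix.submatrix_apply, Matrix.of_apply, id, h2, h3]
    fin_cases b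
    · have : Fin.cast (by omega : 2 * n = n + n) (finProdFinEquiv ((0 : Fin 2), a)) =
        Fin.castAdd n a := Fin.ext (by simp [finProdFinEquiv])
      simp [this]
    · have : Fin.cast (by omega : 2 * n = n + n) (finProdFinEquiv ((1 : Fin 2), a)) =
        Fin.natAdd n a := Fin.ext (by simp [finProdFinEquiv])
      simp [this, -Fin.natAdd_eq_addNat]
  rw [h1] at h
  rw [h, norm_mul]
  have hs : ‖((Equiv.Perm.sign (deinterleave n) : ℤ) : ℂ)‖ = 1 := by
    rcases Int.units_eq_one_or (Equiv.Perm.sign (deinterleave n)) with h | h <;> simp [h]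
  rw [hs, one_mul, ← Matrix.det_submatrix_equiv_self (finCongr (by omega : n + n = 2 * n))]
  rfl

/-- The matrix has blocks `1, 1` over `i, -i`, with determinant `det(-i - i)`. What matters later is
that the value is nonzero and can be cancelled. -/
theorem covectorWedge_append_smul_I {n : ℕ} {V : Type*} [AddCommGroup V] [Module ℂ V]
    (b : Module.Basis (Fin n) ℂ V) :
    covectorWedge 1 (Fin.append (fun j => (b.coord j).restrictScalars ℝ)
      (fun j => Complex.conjAe.toLinearMap ∘ₗ (b.coord j).restrictScalars ℝ))
      (Fin.append b (fun j => Complex.I • b j)) = (-2 * Complex.I) ^ n := by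
  rw [covectorWedge_apply, one_mul, ← Matrix.det_submatrix_equiv_self finSumFinEquiv]
  have : (Matrix.of fun j i => (Fin.append (fun j => (b.coord j).restrictScalars ℝ)
      (fun j => Complex.conjAe.toLinearMap ∘ₗ (b.coord j).restrictScalars ℝ)) i
      ((Fin.append b (fun j => Complex.I • b j)) j)).submatrix finSumFinEquiv finSumFinEquiv =
      Matrix.fromBlocks 1 1 (Complex.I • (1 : Matrix (Fin n) (Fin n) ℂ))
        (-Complex.I • (1 : Matrix (Fin n) (Fin n) ℂ)) := by
    ext (i | i) (j | j) <;>
      simp [Matrix.one_apply, Finsupp.single_apply, apply_ite (starRingEnd ℂ),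
        apply_ite (Neg.neg : ℂ → ℂ), -Fin.natAdd_eq_addNat]
  rw [this, Matrix.det_fromBlocks_one₁₁, mul_one, ← sub_smul, Matrix.det_smul]
  simp
  ring

end WedgeDet

/-! ### Unitary frames and the normalisation of the holomorphic volume form -/

section UnitaryFrame

variable {V : Type*} [NormedAddCommGroup V] [NormedSpace ℂ V]

/-- On the complex span of `e`, `B` behaves as the imaginary part of a Hermitian form with `e`
orthonormal; splitting `z` and `w` into real and imaginary parts shows it. -/
theorem apply_smul_smul_of_unitary {n : ℕ} (B : V →ₗ[ℝ] V →ₗ[ℝ] ℝ) (e : Fin n → V)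
    (hB : ∀ v w, B v w = - B w v) (hJ : ∀ v w, B (Complex.I • v) (Complex.I • w) = B v w)
    (h0 : ∀ i j, B (e i) (e j) = 0)
    (h1 : ∀ i j, B (e i) (Complex.I • e j) = if i = j then 1 else 0)
    (i j : Fin n) (z w : ℂ) :
    B (z • e i) (w • e j) = if i = j then (starRingEnd ℂ z * w).im else 0 := by
  have hz (z : ℂ) (v : V) : z • v = z.re • v + z.im • (Complex.I • v) := by
    conv_lhs => rw [← Complex.re_add_im z]
    rw [add_smul, mul_smul]
    rfl
  have h2 : B (Complex.I • e i) (e j) = if i = j then -1 else 0 := by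
    rw [hB, h1]
    by_cases h : i = j <;> simp [h, eq_comm]
  rw [hz z, hz w]
  simp only [map_add, LinearMap.add_apply, map_smul, LinearMap.smul_apply, h0, h1, hJ, h2,
    smul_eq_mul]
  split_ifs <;> simp
  ring

/-- Pairing a relation `∑ z_j e_j = 0` with `w • e i` gives `Im(z̄_i w) = 0`; `w = 1` and `w = i`
kill both parts of `z_i`. -/
theorem linearIndependent_of_unitary {n : ℕ} (B : V →ₗ[ℝ] V →ₗ[ℝ] ℝ) (e : Fin n → V)
    (hB : ∀ v w, B v w = - B w v) (hJ : ∀ v w, B (Complex.I • v) (Complex.I • w) = B v w)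
    (h0 : ∀ i j, B (e i) (e j) = 0)
    (h1 : ∀ i j, B (e i) (Complex.I • e j) = if i = j then 1 else 0) :
    LinearIndependent ℂ e := by
  rw [Fintype.linearIndependent_iff]
  intro z hz i
  have h (w : ℂ) : (starRingEnd ℂ (z i) * w).im = 0 := by
    have : B (∑ j, z j • e j) (w • e i) = 0 := by rw [hz]; simp
    rw [map_sum, LinearMap.sum_apply] at this
    simpa [apply_smul_smul_of_unitary B e hB hJ h0 h1] using this
  have h1 := h 1
  have h2 := h Complex.I
  simp at h1 h2
  exact Complex.ext h2 h1

/-- This is the normal form `(i/2) ∑ dz_j ∧ dz̄_j` of a Kähler form in unitary coordinates. -/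
theorem two_form_eq_of_unitary {n : ℕ} (B : V →ₗ[ℝ] V →ₗ[ℝ] ℝ)
    (hB : ∀ v w, B v w = - B w v) (hJ : ∀ v w, B (Complex.I • v) (Complex.I • w) = B v w)
    (b : Module.Basis (Fin n) ℂ V)
    (h0 : ∀ i j, B (b i) (b j) = 0)
    (h1 : ∀ i j, B (b i) (Complex.I • b j) = if i = j then 1 else 0) (v w : V) :
    (B v w : ℂ) = ∑ j, Complex.I / 2 * (b.coord j v * starRingEnd ℂ (b.coord j w) -
      b.coord j w * starRingEnd ℂ (b.coord j v)) := by
  have : B v w = ∑ j, (starRingEnd ℂ (b.coord j v) * b.coord j w).im := by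
    conv_lhs => rw [← b.sum_repr v, ← b.sum_repr w]
    simp only [map_sum, LinearMap.sum_apply, apply_smul_smul_of_unitary B b hB hJ h0 h1,
      Finset.mem_univ, if_true, Finset.sum_ite_eq', Module.Basis.coord_apply]
  rw [this, Complex.ofReal_sum]
  refine Finset.sum_congr rfl fun j _ => ?_
  apply Complex.ext <;> simp <;> ring

theorem apply_pair_swap {V : Type*} [AddCommGroup V] [Module ℝ V] [TopologicalSpace V]
    (κ : V [⋀^Fin 2]→L[ℝ] ℝ) (v w : V) : κ ![v, w] = - κ ![w, v] := by
  have := κ.toAlternatingMap.map_swap ![w, v] (i := 0) (j := 1) (by simp)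
  have h2 : (![w, v] ∘ Equiv.swap 0 1 : Fin 2 → V) = ![v, w] := by
    ext i; fin_cases i <;> simp
  rw [h2] at this
  exact this

/-- The bilinear form of an alternating `2`-form. -/
def pairing {V : Type*} [AddCommGroup V] [Module ℝ V] [TopologicalSpace V]
    (κ : V [⋀^Fin 2]→L[ℝ] ℝ) : V →ₗ[ℝ] V →ₗ[ℝ] ℝ :=
  LinearMap.mk₂ ℝ (fun v w => κ ![v, w])
    (fun v v' w => κ.toAlternatingMap.map_vecCons_add _ _ _)
    (fun c v w => κ.toAlternatingMap.map_vecCons_smul _ _ _)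
    (fun v w w' => by
      rw [apply_pair_swap, apply_pair_swap κ v w, apply_pair_swap κ v w', ← neg_add]
      exact congrArg _ (κ.toAlternatingMap.map_vecCons_add _ _ _))
    (fun c v w => by
      rw [apply_pair_swap, apply_pair_swap κ v w, smul_neg]
      exact congrArg _ (κ.toAlternatingMap.map_vecCons_smul _ _ _))

theorem pairing_apply {V : Type*} [AddCommGroup V] [Module ℝ V] [TopologicalSpace V]
    (κ : V [⋀^Fin 2]→L[ℝ] ℝ) (v w : V) : pairing κ v w = κ ![v, w] := rfl

/-- A unitary basis of a Lagrangian plane has unit complex volume. -/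
theorem norm_apply_of_unitary {n : ℕ} [NeZero n] (hn : Module.finrank ℂ V = n)
    (κ : V [⋀^Fin 2]→L[ℝ] ℝ) (Ω : V [⋀^Fin n]→L[ℂ] ℂ)
    (hJ : ∀ v w, κ ![Complex.I • v, Complex.I • w] = κ ![v, w])
    (hvol : ∀ v : Fin (2 * n) → V, (-1 : ℂ) ^ (n * (n - 1) / 2) * (Complex.I / 2) ^ n *
        wedge (Ω.restrictScalars ℝ).toAlternatingMap
          (Complex.conjCLE.toLinearMap.compAlternatingMap (Ω.restrictScalars ℝ).toAlternatingMap)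
          (fun i => v (Fin.cast (by omega) i)) =
      ((n.factorial : ℂ)⁻¹) *
        wedgePow (Complex.ofRealCLM.toLinearMap.compAlternatingMap κ.toAlternatingMap) n v)
    (e : Fin n → V) (h0 : ∀ i j, κ ![e i, e j] = 0)
    (h1 : ∀ i j, κ ![e i, Complex.I • e j] = if i = j then 1 else 0) :
    ‖Ω e‖ = 1 := by
  have hB := apply_pair_swap κ
  have hli := linearIndependent_of_unitary (pairing κ) e hB hJ h0 h1
  obtain ⟨b, rfl⟩ : ∃ b : Module.Basis (Fin n) ℂ V, ⇑b = e :=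
    ⟨basisOfLinearIndependentOfCardEqFinrank hli (by simp [hn]), by simp⟩
  set η : Fin n → V →ₗ[ℝ] ℂ := fun j => (b.coord j).restrictScalars ℝ with hη
  set ζ : Fin n → V →ₗ[ℝ] ℂ :=
    fun j => Complex.conjAe.toLinearMap ∘ₗ (b.coord j).restrictScalars ℝ with hζ
  have hΩ v : Ω v = Ω b * b.det v := by
    have := DFunLike.congr_fun (Ω.toAlternatingMap.eq_smul_basis_det b) v
    exact this
  have e2 : Complex.conjCLE.toLinearMap.compAlternatingMap
      (Ω.restrictScalars ℝ).toAlternatingMap = covectorWedge (starRingEnd ℂ (Ω b)) ζ := by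
    ext v
    rw [covectorWedge_apply, ← Matrix.det_transpose]
    change starRingEnd ℂ (Ω v) = _
    rw [hΩ v, map_mul, Module.Basis.det_apply, RingHom.map_det]
    rfl
  have e1 : (Ω.restrictScalars ℝ).toAlternatingMap = covectorWedge (Ω b) η := by
    ext v
    rw [covectorWedge_apply, ← Matrix.det_transpose]
    exact hΩ v
  have e3 : Complex.ofRealCLM.toLinearMap.compAlternatingMap κ.toAlternatingMap =
      ∑ j, covectorWedge (Complex.I / 2) (fun i => ![η, ζ] i j) := by
    ext v
    have hv : v = ![v 0, v 1] := by ext i; fin_cases i <;> rfl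
    rw [alternatingMap_sum_apply]
    simp only [covectorWedge_apply, Matrix.det_fin_two, Matrix.of_apply]
    have := two_form_eq_of_unitary (pairing κ) hB hJ b h0 h1 (v 0) (v 1)
    rw [pairing_apply, ← hv] at this
    refine this.trans (Finset.sum_congr rfl fun j _ => ?_)
    simp [hη, hζ, mul_comm]
  -- On the vectors `b, i b` both sides become multiples of `(-2i)^n`. After taking norms, `n!` and
  -- the powers of 2 cancel and `|Ω b|² = 1` remains.
  have h := hvol (fun i => Fin.append b (fun j => Complex.I • b j) (Fin.cast (by omega) i))
  rw [e2, e1, e3, wedgePow_sum_self, wedge_covectorWedge] at h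
  have h' := congrArg norm h
  have key : covectorWedge 1 (Fin.append η ζ) (Fin.append b (fun j => Complex.I • b j)) =
    (-2 * Complex.I) ^ n := covectorWedge_append_smul_I b
  have hc (c : ℂ) (v) : covectorWedge c (Fin.append η ζ) v =
      c * covectorWedge 1 (Fin.append η ζ) v := by
    simp [covectorWedge_apply]
  have hne : (n.factorial : ℝ) ≠ 0 := by positivity
  rw [AlternatingMap.smul_apply, norm_mul, norm_mul, nsmul_eq_mul, norm_mul, norm_mul,
    norm_covectorWedge_interleave] at h'
  simp only [Fin.cast_cast, Fin.cast_eq_self, Matrix.cons_val_zero, Matrix.cons_val_one] at h'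
  rw [hc, hc (_ ^ _), key] at h'
  simp [hne] at h'
  have h2 : ‖Ω b‖ * ‖Ω b‖ = 1 := by
    field_simp at h'
    linarith
  nlinarith [norm_nonneg (Ω b)]

end UnitaryFrame

/-! ### Orthonormal frames and top-degree forms -/

section Frames

variable {T : Type*} [AddCommGroup T] [Module ℝ T]

theorem exists_orthonormal_frame {n : ℕ} [NeZero n] (hn : Module.finrank ℝ T = n)
    (B : T →ₗ[ℝ] T →ₗ[ℝ] ℝ) (hsymm : ∀ v w, B v w = B w v) (hpos : ∀ v, v ≠ 0 → 0 < B v v) :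
    ∃ b : Module.Basis (Fin n) ℝ T, ∀ i j, B (b i) (b j) = if i = j then 1 else 0 := by
  have : FiniteDimensional ℝ T :=
    Module.finite_of_finrank_pos (hn ▸ Nat.pos_of_ne_zero (NeZero.ne n))
  let c : InnerProductSpace.Core ℝ T :=
    { inner := fun v w => B v w
      conj_inner_symm := fun v w => hsymm w v
      re_inner_nonneg := fun v => by
        by_cases h : v = 0
        · simp [h]
        · exact (hpos v h).le
      add_left := fun v w u => by simp
      smul_left := fun v w r => by simp
      definite := fun v h => by
        by_contra h0
        exact (hpos v h0).ne' h }
  let _ := c.toNormedAddCommGroup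
  let _ := InnerProductSpace.ofCore c.toCore
  let b := (stdOrthonormalBasis ℝ T).reindex (finCongr hn)
  refine ⟨b.toBasis, fun i j => ?_⟩
  have := orthonormal_iff_ite.1 b.orthonormal i j
  rw [OrthonormalBasis.coe_toBasis]
  exact this

theorem exists_positive_orthonormal_frame {n : ℕ} [NeZero n] (hn : Module.finrank ℝ T = n)
    (B : T →ₗ[ℝ] T →ₗ[ℝ] ℝ) (hsymm : ∀ v w, B v w = B w v) (hpos : ∀ v, v ≠ 0 → 0 < B v v)
    (μ : T [⋀^Fin n]→ₗ[ℝ] ℝ) (hμ : μ ≠ 0) :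
    ∃ e : Fin n → T, (∀ i j, B (e i) (e j) = if i = j then 1 else 0) ∧ 0 < μ e := by
  obtain ⟨b, hb⟩ := exists_orthonormal_frame hn B hsymm hpos
  have hne : μ b ≠ 0 := (μ.map_basis_ne_zero_iff b).2 hμ
  rcases hne.lt_or_gt with h | h
  -- Reversing one vector keeps the frame orthonormal and flips the orientation; index `0` exists
  -- because `n ≠ 0`.
  · refine ⟨update b 0 (-b 0), fun i j => ?_, ?_⟩
    · rcases eq_or_ne i 0 with rfl | hi <;> rcases eq_or_ne j 0 with rfl | hj <;>
        simp [*, Ne.symm]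
    · have := μ.map_update_smul b 0 (-1) (b 0)
      simp only [neg_smul, one_smul, update_eq_self] at this
      rw [this]
      linarith
  · exact ⟨b, hb, h⟩

theorem linearIndependent_of_orthonormal {n : ℕ} (B : T →ₗ[ℝ] T →ₗ[ℝ] ℝ) (e : Fin n → T)
    (he : ∀ i j, B (e i) (e j) = if i = j then 1 else 0) : LinearIndependent ℝ e := by
  rw [Fintype.linearIndependent_iff]
  intro z hz i
  have : B (∑ j, z j • e j) (e i) = 0 := by rw [hz]; simp
  rw [map_sum, LinearMap.sum_apply] at this
  simpa [he] using this

theorem exists_basis_of_orthonormal {n : ℕ} [NeZero n] (hn : Module.finrank ℝ T = n)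
    (B : T →ₗ[ℝ] T →ₗ[ℝ] ℝ) (e : Fin n → T)
    (he : ∀ i j, B (e i) (e j) = if i = j then 1 else 0) :
    ∃ b : Module.Basis (Fin n) ℝ T, ⇑b = e ∧ ∀ v i, b.repr v i = B v (e i) := by
  have hli := linearIndependent_of_orthonormal B e he
  have hb : ⇑(basisOfLinearIndependentOfCardEqFinrank hli (by simp [hn])) = e := by simp
  refine ⟨_, hb, fun v i => ?_⟩
  set b := basisOfLinearIndependentOfCardEqFinrank hli (by simp [hn])
  conv_rhs => rw [← b.sum_repr v]
  rw [map_sum, LinearMap.sum_apply]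
  simp [hb, he]

/-- For a top-degree form of unit length, contraction with `m` of its arguments is an isometry up
to a factor. -/
theorem sum_mul_cons_snoc {m : ℕ} (ν : T [⋀^Fin (m + 1)]→ₗ[ℝ] ℝ)
    (b : Module.Basis (Fin (m + 1)) ℝ T) (hν : ν b = 1) (w v : T) :
    ∑ i : Fin m → Fin (m + 1), ν (Fin.cons w (b ∘ i)) * ν (Fin.snoc (b ∘ i) v : Fin (m + 1) → T) =
      ((Equiv.Perm.sign (finRotate (m + 1)) : ℤ) : ℝ) * (m.factorial *
        ∑ a, b.repr w a * b.repr v a) := by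
  set s : ℝ := ((Equiv.Perm.sign (finRotate (m + 1)) : ℤ) : ℝ) with hs
  have hrot (i : Fin m → T) (v : T) :
      ν (Fin.snoc i v : Fin (m + 1) → T) = s * ν (Fin.cons v i) := by
    rw [Fin.snoc_eq_cons_rotate]
    have := ν.map_perm (Fin.cons v i) (finRotate (m + 1))
    rw [Units.smul_def, zsmul_eq_mul] at this
    exact this
  have hcons (i : Fin m → Fin (m + 1)) (v : T) :
      ν (Fin.cons v (b ∘ i)) = ∑ a, b.repr v a * ν (b ∘ (Fin.cons a i : Fin (m + 1) → _)) := by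
    conv_lhs => rw [← b.sum_repr v]
    have : ∀ u, ν (Fin.cons u (b ∘ i)) = ν.curryLeft u (b ∘ i) := fun _ => rfl
    rw [this, map_sum]
    simp only [map_smul]
    rw [alternatingMap_sum_apply]
    refine Finset.sum_congr rfl fun a _ => ?_
    rw [AlternatingMap.smul_apply, smul_eq_mul, ← this, Fin.comp_cons]
  have hsq (i : Fin (m + 1) → Fin (m + 1)) (hi : Injective i) : ν (b ∘ i) * ν (b ∘ i) = 1 := by
    let σ : Equiv.Perm (Fin (m + 1)) := Equiv.ofBijective i (Finite.injective_iff_bijective.1 hi)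
    have : ν (b ∘ σ) = _ := ν.map_perm b σ
    rw [hν] at this
    change ν (b ∘ σ) * ν (b ∘ σ) = 1
    rw [this]
    rcases Int.units_eq_one_or (Equiv.Perm.sign σ) with h | h <;> simp [h]
  have hzero (i : Fin (m + 1) → Fin (m + 1)) (hi : ¬ Injective i) : ν (b ∘ i) = 0 := by
    apply ν.map_eq_zero_of_not_injective
    exact fun h => hi h.of_comp
  -- For fixed `a`, the tuples `i` with `(a, i)` injective are the `m!` bijections onto the
  -- complement of `a`; each contributes `(±1)² = 1`.
  have hcount (a : Fin (m + 1)) : ∑ i : Fin m → Fin (m + 1),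
      ν (b ∘ (Fin.cons a i : Fin (m + 1) → _)) * ν (b ∘ (Fin.cons a i : Fin (m + 1) → _)) =
      m.factorial := by
    have := Finset.sum_of_injOn (s := (Finset.univ : Finset (Equiv.Perm (Fin m))))
      (t := Finset.univ) (f := fun _ => (1 : ℝ)) (g := fun i : Fin m → Fin (m + 1) =>
        ν (b ∘ (Fin.cons a i : Fin (m + 1) → _)) * ν (b ∘ (Fin.cons a i : Fin (m + 1) → _)))
      (fun σ => a.succAbove ∘ σ) ?_ (fun _ _ => by simp) ?_ ?_
    · rw [← this]
      simp [Fintype.card_perm]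
    · intro σ _ τ _ h
      ext x
      exact congrArg Fin.val (Fin.succAbove_right_injective (congrFun h x))
    · intro i _ hi
      rw [hzero, zero_mul]
      intro hinj
      rw [Fin.cons_injective_iff] at hinj
      have h1 : ∀ x, ∃ y, a.succAbove y = i x := fun x =>
        Fin.exists_succAbove_eq (fun h => hinj.1 ⟨x, h⟩)
      choose j hj using h1
      have hjinj : Injective j := fun x y h => hinj.2 (by rw [← hj, ← hj, h])
      exact hi ⟨Equiv.ofBijective j (Finite.injective_iff_bijective.1 hjinj), by simp,
        funext fun x => hj x⟩
    · intro σ _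
      refine (hsq _ ?_).symm
      rw [Fin.cons_injective_iff]
      exact ⟨by rintro ⟨x, hx⟩; exact Fin.succAbove_ne _ _ hx,
        Fin.succAbove_right_injective.comp σ.injective⟩
  -- If `(a, i)` is injective it is surjective and hits `a'`. Since `a ≠ a'`, the value `a'` lies in
  -- the range of `i`, so `(a', i)` is not injective.
  have hoff (a a' : Fin (m + 1)) (h : a ≠ a') (i : Fin m → Fin (m + 1)) :
      ν (b ∘ (Fin.cons a i : Fin (m + 1) → _)) * ν (b ∘ (Fin.cons a' i : Fin (m + 1) → _)) = 0 := by
    by_cases h1 : Injective (Fin.cons a i : Fin (m + 1) → Fin (m + 1))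
    · by_cases h2 : Injective (Fin.cons a' i : Fin (m + 1) → Fin (m + 1))
      · exfalso
        obtain ⟨y, hy⟩ := Finite.surjective_of_injective h1 a'
        refine Fin.cases (fun h0 => h h0) (fun x hx => ?_) y hy
        rw [Fin.cons_injective_iff] at h2
        exact h2.1 ⟨x, by simpa using hx⟩
      · rw [hzero _ h2, mul_zero]
    · rw [hzero _ h1, zero_mul]
  calc _ = ∑ i : Fin m → Fin (m + 1), s * ∑ a, ∑ a', b.repr w a * b.repr v a' *
        (ν (b ∘ (Fin.cons a i : Fin (m + 1) → _)) * ν (b ∘ (Fin.cons a' i : Fin (m + 1) → _))) := by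
        refine Finset.sum_congr rfl fun i _ => ?_
        rw [hrot, hcons, hcons, mul_left_comm, Finset.sum_mul_sum]
        congr 1
        refine Finset.sum_congr rfl fun a _ => Finset.sum_congr rfl fun a' _ => ?_
        ring
    _ = ∑ i : Fin m → Fin (m + 1), s * ∑ a, b.repr w a * b.repr v a *
        (ν (b ∘ (Fin.cons a i : Fin (m + 1) → _)) * ν (b ∘ (Fin.cons a i : Fin (m + 1) → _))) := by
        refine Finset.sum_congr rfl fun i _ => ?_
        congr 1
        refine Finset.sum_congr rfl fun a _ => ?_
        refine Finset.sum_eq_single a (fun a' _ h => ?_) (by simp)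
        rw [hoff a a' h.symm, mul_zero]
    _ = _ := by
        rw [← Finset.mul_sum, Finset.sum_comm, Finset.mul_sum Finset.univ _ (m.factorial : ℝ)]
        congr 1
        refine Finset.sum_congr rfl fun a _ => ?_
        rw [← Finset.mul_sum, hcount, mul_comm]

end Frames

/-! ### Linear algebra of special Lagrangian planes -/

section LagrangianPlane

variable {V : Type*} [NormedAddCommGroup V] [NormedSpace ℂ V]
  {T : Type*} [AddCommGroup T] [Module ℝ T]

/-- The metric induced by `κ(·, i ·)` under a linear map. -/
def inducedMetric (κ : V [⋀^Fin 2]→L[ℝ] ℝ) (A : T →ₗ[ℝ] V) : T →ₗ[ℝ] T →ₗ[ℝ] ℝ :=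
  (pairing κ).compl₁₂ A (((LinearMap.lsmul ℂ V Complex.I).restrictScalars ℝ) ∘ₗ A)

theorem inducedMetric_apply (κ : V [⋀^Fin 2]→L[ℝ] ℝ) (A : T →ₗ[ℝ] V) (v w : T) :
    inducedMetric κ A v w = κ ![A v, Complex.I • A w] := rfl

/-- Invariance under `i` and `i² = -1` convert the antisymmetry of `κ` into symmetry. -/
theorem inducedMetric_symm (κ : V [⋀^Fin 2]→L[ℝ] ℝ)
    (hJ : ∀ v w, κ ![Complex.I • v, Complex.I • w] = κ ![v, w]) (A : T →ₗ[ℝ] V) (v w : T) :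
    inducedMetric κ A v w = inducedMetric κ A w v := by
  have h : κ ![Complex.I • A v, -A w] = -κ ![Complex.I • A v, A w] :=
    map_neg (pairing κ (Complex.I • A v)) (A w)
  rw [inducedMetric_apply, inducedMetric_apply, ← hJ, smul_smul, Complex.I_mul_I, neg_one_smul,
    h, apply_pair_swap κ (A w)]

theorem inducedMetric_pos (κ : V [⋀^Fin 2]→L[ℝ] ℝ)
    (hpos : ∀ v, v ≠ 0 → 0 < κ ![v, Complex.I • v]) (A : T →ₗ[ℝ] V) (hA : Injective A) (v : T)
    (hv : v ≠ 0) : 0 < inducedMetric κ A v v :=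
  hpos _ ((map_ne_zero_iff A hA).2 hv)

/-- The complexification of a Lagrangian plane is the whole space. -/
theorem exists_eq_add_I_smul {n : ℕ} [NeZero n] (hn : Module.finrank ℂ V = n)
    (κ : V [⋀^Fin 2]→L[ℝ] ℝ) (hJ : ∀ v w, κ ![Complex.I • v, Complex.I • w] = κ ![v, w])
    (A : T →ₗ[ℝ] V) (hκ : ∀ v w, κ ![A v, A w] = 0) (e : Fin n → T)
    (he : ∀ i j, inducedMetric κ A (e i) (e j) = if i = j then 1 else 0) (x : V) :
    ∃ u w : T, x = A u + Complex.I • A w := by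
  have hli := linearIndependent_of_unitary (pairing κ) (A ∘ e) (apply_pair_swap κ) hJ
    (fun i j => hκ _ _) he
  have hb : ⇑(basisOfLinearIndependentOfCardEqFinrank hli (by simp [hn])) = A ∘ e := by simp
  set b := basisOfLinearIndependentOfCardEqFinrank hli (by simp [hn])
  refine ⟨∑ i, (b.repr x i).re • e i, ∑ i, (b.repr x i).im • e i, ?_⟩
  conv_lhs => rw [← b.sum_repr x]
  rw [map_sum, map_sum, Finset.smul_sum, ← Finset.sum_add_distrib]
  refine Finset.sum_congr rfl fun i _ => ?_
  conv_lhs => rw [← Complex.re_add_im (b.repr x i)]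
  rw [hb, map_smul, map_smul, add_smul, mul_comm, mul_smul]
  rfl

/-- The tangential part `A u` pairs to zero by the Lagrangian condition. The minus sign comes from
exchanging the arguments of `κ`, and is the source of the sign in `⋆θ = -φ`. -/
theorem apply_add_I_smul (κ : V [⋀^Fin 2]→L[ℝ] ℝ)
    (hJ : ∀ v w, κ ![Complex.I • v, Complex.I • w] = κ ![v, w])
    (A : T →ₗ[ℝ] V) (hκ : ∀ v w, κ ![A v, A w] = 0) (u w v : T) :
    κ ![A u + Complex.I • A w, A v] = -inducedMetric κ A w v := by
  have h : κ ![A u + Complex.I • A w, A v] = κ ![A u, A v] + κ ![Complex.I • A w, A v] :=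
    LinearMap.map_add₂ (pairing κ) (A u) (Complex.I • A w) (A v)
  rw [h, hκ, zero_add, apply_pair_swap, inducedMetric_symm κ hJ]
  rfl

/-- The tangential part contributes a real number, and `Im(i z) = Re z` for the rest. -/
theorem im_apply_cons_add_I_smul {m : ℕ} (Ω : V [⋀^Fin (m + 1)]→L[ℂ] ℂ) (A : T →ₗ[ℝ] V)
    (hΩ : ∀ v : Fin (m + 1) → T, (Ω (A ∘ v)).im = 0) (u w : T) (v : Fin m → T) :
    (Ω (Fin.cons (A u + Complex.I • A w) (A ∘ v))).im = (Ω (A ∘ (Fin.cons w v))).re := by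
  have h1 : Ω (Fin.cons (A u + Complex.I • A w) (A ∘ v)) =
      Ω (Fin.cons (A u) (A ∘ v)) + Ω (Fin.cons (Complex.I • A w) (A ∘ v)) :=
    Ω.toAlternatingMap.map_vecCons_add _ _ _
  have h2 : Ω (Fin.cons (Complex.I • A w) (A ∘ v)) =
      Complex.I • Ω (Fin.cons (A w) (A ∘ v)) :=
    Ω.toAlternatingMap.map_vecCons_smul _ _ _
  have h3 := hΩ (Fin.cons u v)
  rw [Fin.comp_cons] at h3 ⊢
  rw [h1, h2, Complex.add_im, h3]
  simp

/-- Contraction with a normal vector to a hyperplane annihilates the normal directions. -/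
theorem apply_cons_eq_of_orthogonal {m : ℕ} (G : T →ₗ[ℝ] T →ₗ[ℝ] ℝ)
    (hpos : ∀ v, v ≠ 0 → 0 < G v v)
    (ν : T [⋀^Fin (m + 1)]→ₗ[ℝ] ℝ) (ℓ : T →ₗ[ℝ] ℝ) (w : T) (hw : ∀ x, ℓ x = 0 → G w x = 0)
    (v u : Fin m → T) (huv : ∀ i x, ℓ x = 0 → G (v i - u i) x = 0) :
    ν (Fin.cons w v) = ν (Fin.cons w u) := by
  by_cases hw0 : w = 0
  · subst hw0
    rw [ν.map_coord_zero (0 : Fin (m + 1)) rfl, ν.map_coord_zero (0 : Fin (m + 1)) rfl]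
  have hℓ : ℓ w ≠ 0 := fun h => (hpos w hw0).ne' (hw w h)
  -- The multiple of `w` is chosen so that the remainder lies in the kernel of `ℓ`. The remainder is
  -- also orthogonal to that kernel, hence to itself, and so vanishes.
  have hc i : v i = u i + (ℓ (v i - u i) / ℓ w) • w := by
    set c := ℓ (v i - u i) / ℓ w
    by_contra h
    have hx : ℓ (v i - u i - c • w) = 0 := by
      simp only [map_sub ℓ _ (c • w), map_smul, smul_eq_mul, c]
      field_simp
      simp
    have hne : v i - u i - c • w ≠ 0 := fun h0 => h (by rw [← sub_eq_zero, ← h0]; abel)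
    apply (hpos _ hne).ne'
    rw [LinearMap.map_sub₂, LinearMap.map_smul₂, huv i _ hx, hw _ hx]
    simp
  -- The arguments are exchanged one at a time; each correction term contains `w` twice.
  have key (s : Finset (Fin m)) :
      ν.curryLeft w (s.piecewise v u) = ν.curryLeft w u := by
    induction s using Finset.induction_on with
    | empty => simp
    | insert i s hi ih =>
      rw [Finset.piecewise_insert, hc i, AlternatingMap.map_update_add,
        AlternatingMap.map_update_smul]
      have h1 : ν.curryLeft w (update (s.piecewise v u) i w) = 0 :=
        ν.map_eq_zero_of_eq _ (i := 0) (j := i.succ) (by simp) (Fin.succ_ne_zero i).symm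
      have h2 : update (s.piecewise v u) i (u i) = s.piecewise v u := by
        rw [update_eq_self_iff, Finset.piecewise_eq_of_notMem _ _ _ hi]
      rw [h1, smul_zero, add_zero, h2, ih]
  have := key Finset.univ
  rw [Finset.piecewise_univ] at this
  exact this

end LagrangianPlane

/-! ### The Hodge star in degrees 1 and n - 1 -/

section HodgeStar

variable {E : Type*} [NormedAddCommGroup E] [NormedSpace ℝ E]
  {H : Type*} [TopologicalSpace H] {I : ModelWithCorners ℝ E H}
  {M : Type*} [TopologicalSpace M] [ChartedSpace H M]

theorem iteratedInteriorProd_apply {l : ℕ} {p : M} : ∀ (k : ℕ) (w : Fin k → TangentSpace I p)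
    (α : TangentSpace I p [⋀^Fin (l + k)]→L[ℝ] ℝ) (v : Fin l → TangentSpace I p),
    iteratedInteriorProd k w α v = α (fun i => Fin.append w v (Fin.cast (add_comm l k) i))
  | 0, w, α, v => by
    rw [iteratedInteriorProd]
    congr 1
    funext i
    have : (Fin.cast (add_comm l 0) i) = Fin.natAdd 0 i := Fin.ext (by simp)
    rw [this, Fin.append_right]
  | k + 1, w, α, v => by
    rw [iteratedInteriorProd, iteratedInteriorProd_apply k]
    change α (Fin.cons (w 0) _) = _
    congr 1
    funext i
    refine Fin.cases ?_ (fun i => ?_) i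
    · have : (Fin.cast (add_comm l (k + 1)) (0 : Fin (l + (k + 1)))) = Fin.castAdd l 0 :=
        Fin.ext (by simp)
      rw [this, Fin.append_left]
      rfl
    · have : Fin.append w v = Fin.append (Fin.cons (w 0) (fun i => w i.succ)) v := by
        congr 1
        exact (Fin.cons_self_tail w).symm
      rw [this, Fin.append_cons]
      have h2 : Fin.cast (by omega : k + 1 + l = k + l + 1)
        (Fin.cast (add_comm l (k + 1)) i.succ) = (Fin.cast (add_comm l k) i).succ := rfl
      simp only [Function.comp_apply, h2, Fin.cons_succ]

variable {m : ℕ} (g : ∀ p : M, TangentSpace I p → TangentSpace I p → ℝ)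
  (μ : DForm I M ℝ (m + 1))

theorem orientedFrame_spec {p : M} (h : ∃ e, IsOrientedFrame g μ p e) :
    IsOrientedFrame g μ p (orientedFrame g μ p) := by
  rw [orientedFrame, dif_pos h]
  exact h.choose_spec

/-- Top-degree forms are determined by their value on one basis, and the volume form takes the value
1 on `b`. -/
theorem volForm_eq {p : M} (b : Module.Basis (Fin (m + 1)) ℝ (TangentSpace I p))
    (hb : ⇑b = orientedFrame g μ p) (hpos : μ p b ≠ 0)
    (ν : TangentSpace I p [⋀^Fin (m + 1)]→L[ℝ] ℝ) :
    ν = ν b • volForm g μ p := by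
  have h1 : volForm g μ p b = 1 := by
    rw [volForm, ← hb]
    exact inv_mul_cancel₀ hpos
  apply ContinuousAlternatingMap.toAlternatingMap_injective
  refine Module.Basis.ext_alternating b fun i hi => ?_
  let σ : Equiv.Perm (Fin (m + 1)) := Equiv.ofBijective i (Finite.injective_iff_bijective.1 hi)
  have h2 : ν (b ∘ σ) = _ := ν.toAlternatingMap.map_perm b σ
  have h3 : volForm g μ p (b ∘ σ) = _ := (volForm g μ p).toAlternatingMap.map_perm b σ
  change ν (b ∘ σ) = ν b * volForm g μ p (b ∘ σ)
  rw [h2, h3]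
  change _ • ν b = ν b * (_ • volForm g μ p b)
  rw [h1]
  simp [Units.smul_def, mul_comm]

theorem hodgeStar_apply {k l : ℕ} (h : l + k = m + 1) (α : DForm I M ℝ k) (p : M)
    (v : Fin l → TangentSpace I p) :
    hodgeStar g μ h α p v = (k.factorial : ℝ)⁻¹ * ∑ i : Fin k → Fin (m + 1),
      α p (orientedFrame g μ p ∘ i) * volForm g μ p (fun j =>
        Fin.append (orientedFrame g μ p ∘ i) v (Fin.cast (by omega) j)) := by
  rw [hodgeStar, ContinuousAlternatingMap.smul_apply, ContinuousAlternatingMap.sum_apply,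
    smul_eq_mul]
  congr 1
  refine Finset.sum_congr rfl fun i _ => ?_
  rw [ContinuousAlternatingMap.smul_apply, iteratedInteriorProd_apply, smul_eq_mul]
  rfl

/-- Only linearity in the first slot is involved: the contracting vector is `∑ θ(e_a) e_a`, the
metric dual of `θ` when the frame is orthonormal. -/
theorem hodgeStar_one_apply {p : M} (h : m + 1 = m + 1) (θ : DForm I M ℝ 1)
    (v : Fin m → TangentSpace I p) :
    hodgeStar g μ (k := 1) (l := m) h θ p v =
      volForm g μ p (Fin.cons (∑ a, θ p (fun _ => orientedFrame g μ p a) •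
        orientedFrame g μ p a) v) := by
  have h1 : ∀ u, volForm g μ p (Fin.cons u v) =
    (volForm g μ p).toAlternatingMap.curryLeft u v := fun _ => rfl
  rw [h1, map_sum, alternatingMap_sum_apply, hodgeStar_apply,
    ← (Equiv.funUnique (Fin 1) (Fin (m + 1))).symm.sum_comp]
  simp only [Nat.factorial_one, Nat.cast_one, inv_one, one_mul]
  refine Finset.sum_congr rfl fun a _ => ?_
  rw [map_smul, AlternatingMap.smul_apply, ← h1]
  change θ p (fun _ => orientedFrame g μ p a) * _ = θ p (fun _ => orientedFrame g μ p a) * _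
  congr 2
  funext j
  refine Fin.cases ?_ (fun j => ?_) j
  · have : Fin.cast (by omega : m + 1 = 1 + m) 0 = Fin.castAdd m 0 := Fin.ext (by simp)
    rw [this, Fin.append_left]
    rfl
  · have : Fin.cast (by omega : m + 1 = 1 + m) j.succ = Fin.natAdd 1 j :=
      Fin.ext (by simp; omega)
    rw [this, Fin.append_right]
    rfl

/-- The star puts its free argument last, whereas contraction puts `w` first; the sign is that of
the cyclic rotation relating the two. -/
theorem hodgeStar_contraction_apply {p : M} (h : 1 + m = m + 1) (φ : DForm I M ℝ m)
    (b : Module.Basis (Fin (m + 1)) ℝ (TangentSpace I p))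
    (hb : ⇑b = orientedFrame g μ p) (hpos : μ p b ≠ 0) (w : TangentSpace I p)
    (hφ : ∀ u, φ p u = volForm g μ p (Fin.cons w u)) (v : Fin 1 → TangentSpace I p) :
    hodgeStar g μ (k := m) (l := 1) h φ p v =
      ((Equiv.Perm.sign (finRotate (m + 1)) : ℤ) : ℝ) * ∑ a, b.repr w a * b.repr (v 0) a := by
  have h1 : volForm g μ p b = 1 := by
    rw [volForm, ← hb]
    exact inv_mul_cancel₀ hpos
  have h2 := sum_mul_cons_snoc (volForm g μ p).toAlternatingMap b h1 w (v 0)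
  have hne : (m.factorial : ℝ) ≠ 0 := by positivity
  rw [hodgeStar_apply, inv_mul_eq_iff_eq_mul₀ hne, mul_left_comm, ← h2]
  refine Finset.sum_congr rfl fun i _ => ?_
  rw [hφ, ← hb]
  change volForm g μ p _ * _ = volForm g μ p _ * volForm g μ p _
  congr 2
  rw [Fin.append_right_eq_snoc]
  rfl

end HodgeStar

/-! ### Smooth dependence of pullbacks of alternating forms -/

section AlternatingCalculus

variable {E₁ E₂ F D : Type*} [NormedAddCommGroup E₁] [NormedSpace ℝ E₁]
  [NormedAddCommGroup E₂] [NormedSpace ℝ E₂] [NormedAddCommGroup F] [NormedSpace ℝ F]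
  [NormedAddCommGroup D] [NormedSpace ℝ D]

/-- The projection of continuous multilinear maps onto alternating ones. -/
def antisymmetrize (E F : Type*) [NormedAddCommGroup E] [NormedSpace ℝ E] [NormedAddCommGroup F]
    [NormedSpace ℝ F] (k : ℕ) :
    ContinuousMultilinearMap ℝ (fun _ : Fin k => E) F →L[ℝ] E [⋀^Fin k]→L[ℝ] F :=
  LinearMap.mkContinuous
    { toFun := fun f => (k.factorial : ℝ)⁻¹ • ContinuousMultilinearMap.alternatization f
      map_add' := fun f g => by rw [map_add, smul_add]
      map_smul' := fun c f => by
        ext v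
        simp only [ContinuousAlternatingMap.smul_apply,
          ContinuousMultilinearMap.alternatization_apply_apply, RingHom.id_apply, Finset.smul_sum]
        refine Finset.sum_congr rfl fun σ _ => ?_
        rw [_root_.smul_apply, smul_comm _ c, smul_comm _ c] } 1
    (fun f => by
      refine ContinuousAlternatingMap.opNorm_le_bound _ (by positivity) fun v => ?_
      have hk : (0 : ℝ) < k.factorial := by positivity
      change ‖(k.factorial : ℝ)⁻¹ • ContinuousMultilinearMap.alternatization f v‖ ≤ _
      rw [norm_smul, norm_inv, Real.norm_natCast, inv_mul_le_iff₀ hk,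
        ContinuousMultilinearMap.alternatization_apply_apply]
      refine (norm_sum_le _ _).trans ?_
      have h (σ : Equiv.Perm (Fin k)) :
          ‖Equiv.Perm.sign σ • f (v ∘ σ)‖ ≤ 1 * ‖f‖ * ∏ i, ‖v i‖ := by
        have h1 : ‖Equiv.Perm.sign σ • f (v ∘ σ)‖ = ‖f (v ∘ σ)‖ := by
          rcases Int.units_eq_one_or (Equiv.Perm.sign σ) with h | h <;> simp [h]
        rw [h1, one_mul]
        refine (f.le_opNorm _).trans_eq ?_
        congr 1
        exact Equiv.prod_comp σ fun i => ‖v i‖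
      refine (Finset.sum_le_sum fun σ _ => h σ).trans_eq ?_
      simp [Fintype.card_perm])

theorem antisymmetrize_coe {k : ℕ} (f : E₁ [⋀^Fin k]→L[ℝ] F) :
    antisymmetrize E₁ F k f.toContinuousMultilinearMap = f := by
  ext v
  change (k.factorial : ℝ)⁻¹ •
    ContinuousMultilinearMap.alternatization f.toContinuousMultilinearMap v = _
  rw [ContinuousMultilinearMap.alternatization_apply_apply]
  have h (σ : Equiv.Perm (Fin k)) :
      Equiv.Perm.sign σ • f.toContinuousMultilinearMap (v ∘ σ) = f v := by
    change Equiv.Perm.sign σ • f.toAlternatingMap (v ∘ σ) = f.toAlternatingMap v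
    rw [AlternatingMap.map_perm, smul_smul]
    simp
  have hk : (k.factorial : ℝ) ≠ 0 := by positivity
  simp only [h, Finset.sum_const, Finset.card_univ, Fintype.card_perm, Fintype.card_fin]
  rw [← Nat.cast_smul_eq_nsmul ℝ, smul_smul, inv_mul_cancel₀ hk, one_smul]

/-- Composition is smooth on the space of multilinear maps. The bounded linear map `antisymmetrize`,
a left inverse of the inclusion of alternating maps, brings the conclusion back. -/
theorem _root_.ContDiffWithinAt.alternating_compContinuousLinearMap {k : ℕ} {r : ℕ∞ω} {s : Set D}
    {x : D} {β : D → E₂ [⋀^Fin k]→L[ℝ] F} {a : D → E₁ →L[ℝ] E₂}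
    (hβ : ContDiffWithinAt ℝ r β s x) (ha : ContDiffWithinAt ℝ r a s x) :
    ContDiffWithinAt ℝ r (fun y => (β y).compContinuousLinearMap (a y)) s x := by
  have h1 : ContDiffWithinAt ℝ r (fun y =>
      ContinuousMultilinearMap.compContinuousLinearMapContinuousMultilinear ℝ
        (fun _ : Fin k => E₁) (fun _ : Fin k => E₂) F (fun _ => a y)
        (β y).toContinuousMultilinearMap) s x := by
    refine ContDiffWithinAt.clm_apply ?_ ?_
    · exact (ContinuousMultilinearMap.contDiff _).comp_contDiffWithinAt
        (contDiffWithinAt_pi.2 fun _ => ha)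
    · exact (ContinuousAlternatingMap.toContinuousMultilinearMapCLM ℝ).contDiff.comp_contDiffWithinAt
        hβ
  have h2 := (antisymmetrize E₁ F k).contDiff.comp_contDiffWithinAt h1
  refine h2.congr_of_eventuallyEq (Filter.Eventually.of_forall fun y => ?_) ?_ <;>
  exact (antisymmetrize_coe _).symm

end AlternatingCalculus

/-! ### Closedness of the time contraction of a closed form -/

section Cartan

variable {E E' F : Type*} [NormedAddCommGroup E] [NormedSpace ℝ E]
  [NormedAddCommGroup E'] [NormedSpace ℝ E'] [NormedAddCommGroup F] [NormedSpace ℝ F]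

/-- The contraction with the time direction of a form on `ℝ × E`, restricted to a time slice. -/
def sliceContraction (k : ℕ) :
    ((ℝ × E) [⋀^Fin (k + 1)]→L[ℝ] F) →L[ℝ] E [⋀^Fin k]→L[ℝ] F :=
  (ContinuousAlternatingMap.compContinuousLinearMapCLM (ContinuousLinearMap.inr ℝ ℝ E)).comp
    ((ContinuousLinearMap.apply ℝ _ ((1, 0) : ℝ × E)).comp
      (ContinuousAlternatingMap.curryLeftLI (𝕜 := ℝ) (E := ℝ × E) (F := F)
        (n := k)).toContinuousLinearMap)

theorem sliceContraction_apply {k : ℕ} (η : (ℝ × E) [⋀^Fin (k + 1)]→L[ℝ] F) (v : Fin k → E) :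
    sliceContraction k η v = η (Fin.cons (1, 0) (fun i => (0, v i))) := rfl

/-- Pullback commutes with the exterior derivative within a set at points of the closure of its
interior; this supplies that condition at the end times and at boundary points of `L`. -/
theorem mem_closure_interior_Icc_prod {E : Type*} [TopologicalSpace E] {R : Set E} {z : ℝ × E}
    (hz : z.1 ∈ Icc (0 : ℝ) 1)
    (hzR : z.2 ∈ closure (interior R)) : z ∈ closure (interior (Icc (0 : ℝ) 1 ×ˢ R)) := by
  rw [interior_prod_eq, closure_prod_eq, interior_Icc, closure_Ioo zero_ne_one]
  exact ⟨hz, hzR⟩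

/-- If a closed form on `[0, 1] × R` restricts to zero on all time slices, its contraction with
the time direction is closed on each time slice. -/
theorem extDerivWithin_sliceContraction {k : ℕ} {R : Set E} (hR : UniqueDiffOn ℝ R)
    {η : ℝ × E → (ℝ × E) [⋀^Fin (k + 1)]→L[ℝ] F} {t : ℝ} {y : E} (ht : t ∈ Icc (0 : ℝ) 1)
    (hy : y ∈ R) (hη : DifferentiableWithinAt ℝ η (Icc (0 : ℝ) 1 ×ˢ R) (t, y))
    (hclosed : extDerivWithin η (Icc (0 : ℝ) 1 ×ˢ R) (t, y) = 0)
    (hzero : ∀ᶠ z in 𝓝[Icc (0 : ℝ) 1 ×ˢ R] (t, y),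
      (η z).compContinuousLinearMap (ContinuousLinearMap.inr ℝ ℝ E) = 0) :
    extDerivWithin (fun x => sliceContraction k (η (t, x))) R y = 0 := by
  set K := Icc (0 : ℝ) 1 ×ˢ R
  have hz : (t, y) ∈ K := ⟨ht, hy⟩
  have hK : UniqueDiffOn ℝ K := (uniqueDiffOn_Icc zero_lt_one).prod hR
  have hins : HasFDerivWithinAt (fun x : E => (t, x)) (ContinuousLinearMap.inr ℝ ℝ E) R y :=
    (hasFDerivAt_prodMk_right t y).hasFDerivWithinAt
  have hmaps : MapsTo (fun x : E => (t, x)) R K := fun x hx => ⟨ht, hx⟩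
  have hηc (u : Fin (k + 1) → ℝ × E) : DifferentiableWithinAt ℝ (fun z => η z u) K (t, y) :=
    hη.continuousAlternatingMap_apply_const u
  have hslice (u : Fin (k + 1) → ℝ × E) :
      fderivWithin ℝ (fun x => η (t, x) u) R y =
        (fderivWithin ℝ (fun z => η z u) K (t, y)).comp (ContinuousLinearMap.inr ℝ ℝ E) :=
    ((hηc u).hasFDerivWithinAt.comp y hins hmaps).fderivWithin (hR y hy)
  have hθ : DifferentiableWithinAt ℝ (fun x => sliceContraction k (η (t, x))) R y :=
    DifferentiableAt.comp_differentiableWithinAt (g := sliceContraction (E := E) (F := F) k) y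
      (by exact (sliceContraction (E := E) (F := F) k).differentiableAt)
      (DifferentiableWithinAt.comp y hη hins.differentiableWithinAt hmaps)
  ext v
  set V : Fin (k + 2) → ℝ × E := Fin.cons (1, 0) (fun i => (0, v i)) with hV
  have h0 := DFunLike.congr_fun hclosed V
  rw [extDerivWithin_apply hη (hK _ hz), Fin.sum_univ_succ] at h0
  -- In `dη(∂_t, v_1, …)` the term differentiating in time involves only slice restrictions of `η`,
  -- which vanish nearby.
  have hfirst : fderivWithin ℝ (fun z => η z (Fin.removeNth 0 V)) K (t, y) = 0 := by
    have : (fun z => η z (Fin.removeNth 0 V)) =ᶠ[𝓝[K] (t, y)] fun _ => 0 :=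
      hzero.mono fun z hz => DFunLike.congr_fun hz v
    rw [this.fderivWithin_eq (this.self_of_nhdsWithin hz)]
    simp
  rw [hfirst] at h0
  rw [extDerivWithin_apply hθ (hR y hy)]
  have hrest (j : Fin (k + 1)) :
      fderivWithin ℝ (fun z => η z (Fin.removeNth j.succ V)) K (t, y) (0, v j) =
      fderivWithin ℝ (fun x => sliceContraction k (η (t, x)) (j.removeNth v)) R y (v j) := by
    have : (fun x => sliceContraction k (η (t, x)) (j.removeNth v)) = fun x => η (t, x)
        (Fin.removeNth j.succ V) := by
      funext x
      rw [sliceContraction_apply]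
      congr 1
      funext i
      refine Fin.cases ?_ (fun i => ?_) i <;> simp [Fin.removeNth, hV]
    rw [this, hslice]
    rfl
  -- The remaining terms are those of the slice derivative with indices shifted by one, so together
  -- they equal its negative.
  simp only [_root_.zero_apply, smul_zero, zero_add, show ∀ j, V (Fin.succ j) = (0, v j) from fun _ => rfl,
    hrest,
    Fin.val_succ, pow_succ, mul_neg, mul_one, neg_smul, Finset.sum_neg_distrib] at h0
  exact neg_eq_zero.1 h0

end Cartan

/-! ### Forms and paths of maps in charts -/

section Charts

variable {E : Type*} [NormedAddCommGroup E] [NormedSpace ℝ E]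
  {H : Type*} [TopologicalSpace H] {I : ModelWithCorners ℝ E H}
  {M : Type*} [TopologicalSpace M] [ChartedSpace H M] [IsManifold I 1 M]
  {F : Type*} [NormedAddCommGroup F] [NormedSpace ℝ F]

/-- The derivatives of a chart and of its inverse cancel, so a form can be evaluated in any chart
around the point. -/
theorem chartForm_apply_mfderiv {k : ℕ} (α : DForm I M F k) (x₀ x : M)
    (hx : x ∈ (extChartAt I x₀).source) (v : Fin k → TangentSpace I x) :
    chartForm I α x₀ (extChartAt I x₀ x) (fun i => mfderiv I 𝓘(ℝ, E) (extChartAt I x₀) x (v i)) =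
      α x v := by
  have h1 := mfderivWithin_extChartAt_symm_comp_mfderiv_extChartAt' (I := I) hx
  let β : M → E [⋀^Fin k]→L[ℝ] F := α
  have h2 : β ((extChartAt I x₀).symm (extChartAt I x₀ x)) = β x :=
    congrArg β ((extChartAt I x₀).left_inv hx)
  have h3 : ∀ i, (mfderivWithin 𝓘(ℝ, E) I (extChartAt I x₀).symm (range I) (extChartAt I x₀ x)
      (mfderiv I 𝓘(ℝ, E) (extChartAt I x₀) x (v i)) : E) = (v i : E) := fun i =>
    congrArg (fun A : E →L[ℝ] E => A (v i)) h1
  change β ((extChartAt I x₀).symm (extChartAt I x₀ x)) _ = β x v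
  rw [h2]
  exact congrArg (β x) (funext h3)

theorem chartForm_self {k : ℕ} (α : DForm I M F k) (p : M) (v : Fin k → TangentSpace I p) :
    chartForm I α p (extChartAt I p p) v = α p v := by
  have h := chartForm_apply_mfderiv α p p (mem_extChartAt_source p) v
  rw [mfderiv_extChartAt_self] at h
  exact h

end Charts

section Path

variable (E : Type*) [NormedAddCommGroup E] [NormedSpace ℂ E]
  {X : Type*} [TopologicalSpace X] [ChartedSpace E X]
  {E' : Type*} [NormedAddCommGroup E'] [NormedSpace ℝ E']
  {H : Type*} [TopologicalSpace H] (I : ModelWithCorners ℝ E' H)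
  {L : Type*} [TopologicalSpace L] [ChartedSpace H L]
  (f : ℝ → L → X)

/-- A path of maps in the preferred charts at `p₀` and `x₀`. -/
def localPath (p₀ : L) (x₀ : X) (z : ℝ × E') : E :=
  extChartAt 𝓘(ℝ, E) x₀ (f z.1 ((extChartAt I p₀).symm z.2))

/-- The domain of `localPath`. -/
def localDomain (p₀ : L) (x₀ : X) : Set (ℝ × E') :=
  (Icc (0 : ℝ) 1 ×ˢ (extChartAt I p₀).target) ∩
    (fun z => f z.1 ((extChartAt I p₀).symm z.2)) ⁻¹' (extChartAt 𝓘(ℝ, E) x₀).source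

variable {f}

theorem localDomain_subset (p₀ : L) (x₀ : X) :
    localDomain E I f p₀ x₀ ⊆ Icc (0 : ℝ) 1 ×ˢ range I := fun _ hz =>
  ⟨hz.1.1, extChartAt_target_subset_range p₀ hz.1.2⟩

variable [IsManifold I ∞ L]

theorem contMDiffOn_path_symm
    (hf : ContMDiffOn (𝓘(ℝ, ℝ).prod I) 𝓘(ℝ, E) ∞ (uncurry f) (Icc (0 : ℝ) 1 ×ˢ univ)) (p₀ : L) :
    ContMDiffOn 𝓘(ℝ, ℝ × E') 𝓘(ℝ, E) ∞ (fun z : ℝ × E' => f z.1 ((extChartAt I p₀).symm z.2))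
      (Icc (0 : ℝ) 1 ×ˢ (extChartAt I p₀).target) := by
  have h1 : ContMDiffOn 𝓘(ℝ, ℝ × E') (𝓘(ℝ, ℝ).prod I) ∞
      (fun z : ℝ × E' => (z.1, (extChartAt I p₀).symm z.2))
      (Icc (0 : ℝ) 1 ×ˢ (extChartAt I p₀).target) := by
    refine ContMDiffOn.prodMk contDiff_fst.contMDiff.contMDiffOn ?_
    exact (contMDiffOn_extChartAt_symm p₀).comp contDiff_snd.contMDiff.contMDiffOn
      fun z hz => hz.2
  exact hf.comp h1 fun z hz => ⟨hz.1, mem_univ _⟩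

/-- This relative openness allows all derivatives to be taken within the slab `[0,1] × range I`,
which has unique derivatives. -/
theorem localDomain_mem_nhdsWithin
    (hf : ContMDiffOn (𝓘(ℝ, ℝ).prod I) 𝓘(ℝ, E) ∞ (uncurry f) (Icc (0 : ℝ) 1 ×ˢ univ))
    (p₀ : L) (x₀ : X) {z : ℝ × E'} (hz : z ∈ localDomain E I f p₀ x₀) :
    localDomain E I f p₀ x₀ ∈ 𝓝[Icc (0 : ℝ) 1 ×ˢ range I] z := by
  have h1 : Icc (0 : ℝ) 1 ×ˢ (extChartAt I p₀).target ∈ 𝓝[Icc (0 : ℝ) 1 ×ˢ range I] z := by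
    rw [← Prod.mk.eta (p := z), nhdsWithin_prod_eq]
    exact Filter.prod_mem_prod self_mem_nhdsWithin
      (extChartAt_target_mem_nhdsWithin_of_mem hz.1.2)
  have h2 := (contMDiffOn_path_symm E I hf p₀).continuousOn z hz.1
  have h3 := h2 ((isOpen_extChartAt_source (I := 𝓘(ℝ, E)) x₀).mem_nhds hz.2)
  have h4 : 𝓝[Icc (0 : ℝ) 1 ×ˢ range I] z ≤ 𝓝[Icc (0 : ℝ) 1 ×ˢ (extChartAt I p₀).target] z := by
    rw [nhdsWithin_le_iff]
    exact h1
  exact Filter.inter_mem h1 (h4 h3)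

variable [IsManifold 𝓘(ℝ, E) ∞ X]

theorem contDiffOn_localPath
    (hf : ContMDiffOn (𝓘(ℝ, ℝ).prod I) 𝓘(ℝ, E) ∞ (uncurry f) (Icc (0 : ℝ) 1 ×ˢ univ))
    (p₀ : L) (x₀ : X) : ContDiffOn ℝ ∞ (localPath E I f p₀ x₀) (localDomain E I f p₀ x₀) := by
  rw [← contMDiffOn_iff_contDiffOn]
  refine (contMDiffOn_extChartAt (x := x₀)).comp
    ((contMDiffOn_path_symm E I hf p₀).mono inter_subset_left) fun z hz => ?_
  simpa only [extChartAt_source] using hz.2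

theorem contDiffWithinAt_localPath
    (hf : ContMDiffOn (𝓘(ℝ, ℝ).prod I) 𝓘(ℝ, E) ∞ (uncurry f) (Icc (0 : ℝ) 1 ×ˢ univ))
    (p₀ : L) (x₀ : X) {z : ℝ × E'} (hz : z ∈ localDomain E I f p₀ x₀) :
    ContDiffWithinAt ℝ ∞ (localPath E I f p₀ x₀) (Icc (0 : ℝ) 1 ×ˢ range I) z :=
  ((contDiffOn_localPath E I hf p₀ x₀) z hz).mono_of_mem_nhdsWithin
    (localDomain_mem_nhdsWithin E I hf p₀ x₀ hz)

/-- Both sides differentiate the same slice map within `range I`: one by the chain rule on the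
manifolds, the other by restricting the total derivative. Uniqueness of derivatives identifies them.
-/
theorem mfderiv_localPath_snd
    (hf : ContMDiffOn (𝓘(ℝ, ℝ).prod I) 𝓘(ℝ, E) ∞ (uncurry f) (Icc (0 : ℝ) 1 ×ˢ univ))
    (p₀ : L) (x₀ : X) {s : ℝ} {y : E'} (hz : (s, y) ∈ localDomain E I f p₀ x₀)
    (v : E') : (show E from
    mfderiv 𝓘(ℝ, E) 𝓘(ℝ, E) (extChartAt 𝓘(ℝ, E) x₀) (f s ((extChartAt I p₀).symm y))
      (mfderiv I 𝓘(ℝ, E) (f s) ((extChartAt I p₀).symm y)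
        (mfderivWithin 𝓘(ℝ, E') I (extChartAt I p₀).symm (range I) y v))) =
      fderivWithin ℝ (localPath E I f p₀ x₀) (Icc (0 : ℝ) 1 ×ˢ range I) (s, y) (0, v) := by
  have hs : s ∈ Icc (0 : ℝ) 1 := hz.1.1
  have hy : y ∈ range I := (localDomain_subset E I p₀ x₀ hz).2
  have hfs : MDifferentiableAt I 𝓘(ℝ, E) (f s) ((extChartAt I p₀).symm y) := by
    have h1 : ContMDiff I 𝓘(ℝ, E) ∞ (f s) := by
      rw [← contMDiffOn_univ]
      exact hf.comp (contMDiff_const.prodMk contMDiff_id).contMDiffOn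
        fun p _ => ⟨hs, mem_univ _⟩
    exact (h1 _).mdifferentiableAt (by simp)
  have e1 := (mdifferentiableAt_extChartAt (I := 𝓘(ℝ, E))
    ((extChartAt_source (I := 𝓘(ℝ, E)) x₀ ▸ hz.2 :
      f s ((extChartAt I p₀).symm y) ∈ (chartAt E x₀).source))).hasMFDerivAt
  have e2 := (mdifferentiableWithinAt_extChartAt_symm hz.1.2).hasMFDerivWithinAt
  have e3 := (e1.comp_hasMFDerivWithinAt y (hfs.hasMFDerivAt.comp_hasMFDerivWithinAt y e2))
  have e4 : HasFDerivWithinAt (fun x => localPath E I f p₀ x₀ (s, x)) _ (range I) y :=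
    e3.hasFDerivWithinAt
  have e5 : HasFDerivWithinAt (fun x => localPath E I f p₀ x₀ (s, x)) _ (range I) y :=
    (((contDiffWithinAt_localPath E I hf p₀ x₀ hz).differentiableWithinAt
      (by simp)).hasFDerivWithinAt).comp y (hasFDerivAt_prodMk_right s y).hasFDerivWithinAt
      (fun x hx => ⟨hs, hx⟩)
  exact congrArg (fun A : E' →L[ℝ] E => A v) ((I.uniqueDiffOn y hy).eq e4 e5)

theorem mfderiv_localPath_fst
    (hf : ContMDiffOn (𝓘(ℝ, ℝ).prod I) 𝓘(ℝ, E) ∞ (uncurry f) (Icc (0 : ℝ) 1 ×ˢ univ))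
    (p₀ : L) (x₀ : X) {s : ℝ} {y : E'} (hz : (s, y) ∈ localDomain E I f p₀ x₀) : (show E from
    mfderiv 𝓘(ℝ, E) 𝓘(ℝ, E) (extChartAt 𝓘(ℝ, E) x₀) (f s ((extChartAt I p₀).symm y))
      (velocity f s ((extChartAt I p₀).symm y))) =
      fderivWithin ℝ (localPath E I f p₀ x₀) (Icc (0 : ℝ) 1 ×ˢ range I) (s, y) (1, 0) := by
  have hs : s ∈ Icc (0 : ℝ) 1 := hz.1.1
  have hy : y ∈ range I := (localDomain_subset E I p₀ x₀ hz).2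
  have hfs : MDifferentiableWithinAt 𝓘(ℝ, ℝ) 𝓘(ℝ, E)
      (fun s => f s ((extChartAt I p₀).symm y)) (Icc 0 1) s := by
    have h1 : ContMDiffOn 𝓘(ℝ, ℝ) 𝓘(ℝ, E) ∞ (fun s => f s ((extChartAt I p₀).symm y))
        (Icc 0 1) :=
      hf.comp (contMDiff_id.prodMk contMDiff_const).contMDiffOn fun s hs => ⟨hs, mem_univ _⟩
    exact (h1 s hs).mdifferentiableWithinAt (by simp)
  have e1 := (mdifferentiableAt_extChartAt (I := 𝓘(ℝ, E))
    ((extChartAt_source (I := 𝓘(ℝ, E)) x₀ ▸ hz.2 :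
      f s ((extChartAt I p₀).symm y) ∈ (chartAt E x₀).source))).hasMFDerivAt
  have e3 := e1.comp_hasMFDerivWithinAt s hfs.hasMFDerivWithinAt
  have e4 : HasFDerivWithinAt (fun s => localPath E I f p₀ x₀ (s, y)) _ (Icc 0 1) s :=
    e3.hasFDerivWithinAt
  have e5 : HasFDerivWithinAt (fun s => localPath E I f p₀ x₀ (s, y)) _ (Icc 0 1) s :=
    HasFDerivWithinAt.comp (g := localPath E I f p₀ x₀) (f := fun s => (s, y)) s
      ((contDiffWithinAt_localPath E I hf p₀ x₀ hz).differentiableWithinAt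
        (by simp)).hasFDerivWithinAt (hasFDerivAt_prodMk_left s y).hasFDerivWithinAt
      (fun x hx => ⟨hx, hy⟩)
  exact congrArg (fun A : ℝ →L[ℝ] E => A 1) ((uniqueDiffOn_Icc zero_lt_one s hs).eq e4 e5)

end Path

section LocalForm

variable {E : Type*} [NormedAddCommGroup E] [NormedSpace ℂ E]
  {X : Type*} [TopologicalSpace X] [ChartedSpace E X]
  {n : ℕ} [NeZero n] {L : Type*} [TopologicalSpace L] [ChartedSpace (EuclideanHalfSpace n) L]
  {f : ℝ → L → X} {k : ℕ}

/-- The pullback of a form to the space-time domain of a path of maps, in charts. -/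
def localForm (f : ℝ → L → X) (α : DForm 𝓘(ℝ, E) X ℝ k) (p₀ : L) (x₀ : X)
    (z : ℝ × EuclideanSpace ℝ (Fin n)) : (ℝ × EuclideanSpace ℝ (Fin n)) [⋀^Fin k]→L[ℝ] ℝ :=
  (chartForm 𝓘(ℝ, E) α x₀ (localPath E (𝓡∂ n) f p₀ x₀ z)).compContinuousLinearMap
    (fderivWithin ℝ (localPath E (𝓡∂ n) f p₀ x₀) (Icc (0 : ℝ) 1 ×ˢ range (𝓡∂ n)) z)

theorem uniqueDiffOn_slab :
    UniqueDiffOn ℝ (Icc (0 : ℝ) 1 ×ˢ range (𝓡∂ n)) :=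
  (uniqueDiffOn_Icc zero_lt_one).prod (𝓡∂ n).uniqueDiffOn

theorem localPath_mem_target {p₀ : L} {x₀ : X} {z : ℝ × EuclideanSpace ℝ (Fin n)}
    (hz : z ∈ localDomain E (𝓡∂ n) f p₀ x₀) :
    localPath E (𝓡∂ n) f p₀ x₀ z ∈ (extChartAt 𝓘(ℝ, E) x₀).target :=
  (extChartAt 𝓘(ℝ, E) x₀).map_source hz.2

theorem contDiffAt_chartForm {α : DForm 𝓘(ℝ, E) X ℝ k} (hα : IsSmoothForm 𝓘(ℝ, E) α) (x₀ : X)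
    {y : E} (hy : y ∈ (extChartAt 𝓘(ℝ, E) x₀).target) :
    ContDiffAt ℝ ∞ (chartForm 𝓘(ℝ, E) α x₀) y :=
  (hα x₀).contDiffAt ((isOpen_extChartAt_target x₀).mem_nhds hy)

theorem mem_localDomain {s : ℝ} (hs : s ∈ Icc (0 : ℝ) 1) {p₀ : L} {y : EuclideanSpace ℝ (Fin n)}
    (hy : y ∈ (extChartAt (𝓡∂ n) p₀).target) :
    (s, y) ∈ localDomain E (𝓡∂ n) f p₀ (f s ((extChartAt (𝓡∂ n) p₀).symm y)) :=
  ⟨⟨hs, hy⟩, mem_extChartAt_source _⟩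

variable [IsManifold 𝓘(ℝ, E) ∞ X] [IsManifold (𝓡∂ n) ∞ L]

theorem chartForm_pullbackForm
    (hf : ContMDiffOn (𝓘(ℝ, ℝ).prod (𝓡∂ n)) 𝓘(ℝ, E) ∞ (uncurry f) (Icc (0 : ℝ) 1 ×ˢ univ))
    (α : DForm 𝓘(ℝ, E) X ℝ k) {p₀ : L} {x₀ : X} {s : ℝ} {y : EuclideanSpace ℝ (Fin n)}
    (hz : (s, y) ∈ localDomain E (𝓡∂ n) f p₀ x₀) :
    chartForm (𝓡∂ n) (pullbackForm (𝓡∂ n) 𝓘(ℝ, E) (f s) α) p₀ y =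
      (localForm f α p₀ x₀ (s, y)).compContinuousLinearMap (ContinuousLinearMap.inr ℝ ℝ _) := by
  have : IsManifold 𝓘(ℝ, E) 1 X := .of_le (n := ∞) (by simp)
  ext v
  refine (chartForm_apply_mfderiv (I := 𝓘(ℝ, E)) α x₀ _ hz.2 _).symm.trans ?_
  exact congrArg (chartForm 𝓘(ℝ, E) α x₀ (localPath E (𝓡∂ n) f p₀ x₀ (s, y)))
    (funext fun i => mfderiv_localPath_snd E (𝓡∂ n) hf p₀ x₀ hz (v i))

/-- The derivative of the local path sends `(1, 0)` to the velocity and `(0, v)` to the spatial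
derivative, so the form is the time contraction of the space-time pullback. -/
theorem chartForm_tangentForm
    (hf : ContMDiffOn (𝓘(ℝ, ℝ).prod (𝓡∂ n)) 𝓘(ℝ, E) ∞ (uncurry f) (Icc (0 : ℝ) 1 ×ˢ univ))
    (α : DForm 𝓘(ℝ, E) X ℝ (k + 1)) {p₀ : L} {x₀ : X} {s : ℝ} {y : EuclideanSpace ℝ (Fin n)}
    (hz : (s, y) ∈ localDomain E (𝓡∂ n) f p₀ x₀) :
    chartForm (𝓡∂ n) (tangentForm f α s) p₀ y =
      sliceContraction k (localForm f α p₀ x₀ (s, y)) := by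
  have : IsManifold 𝓘(ℝ, E) 1 X := .of_le (n := ∞) (by simp)
  ext v
  refine (chartForm_apply_mfderiv (I := 𝓘(ℝ, E)) α x₀ _ hz.2 _).symm.trans ?_
  refine congrArg (chartForm 𝓘(ℝ, E) α x₀ (localPath E (𝓡∂ n) f p₀ x₀ (s, y)))
    (funext fun i => ?_)
  refine Fin.cases ?_ (fun i => ?_) i
  · exact mfderiv_localPath_fst E (𝓡∂ n) hf p₀ x₀ hz
  · exact mfderiv_localPath_snd E (𝓡∂ n) hf p₀ x₀ hz (v i)

theorem contDiffWithinAt_localForm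
    (hf : ContMDiffOn (𝓘(ℝ, ℝ).prod (𝓡∂ n)) 𝓘(ℝ, E) ∞ (uncurry f) (Icc (0 : ℝ) 1 ×ˢ univ))
    {α : DForm 𝓘(ℝ, E) X ℝ k} (hα : IsSmoothForm 𝓘(ℝ, E) α) {p₀ : L} {x₀ : X}
    {z : ℝ × EuclideanSpace ℝ (Fin n)} (hz : z ∈ localDomain E (𝓡∂ n) f p₀ x₀) :
    ContDiffWithinAt ℝ ∞ (localForm f α p₀ x₀) (Icc (0 : ℝ) 1 ×ˢ range (𝓡∂ n)) z := by
  have h := contDiffWithinAt_localPath E (𝓡∂ n) hf p₀ x₀ hz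
  refine ContDiffWithinAt.alternating_compContinuousLinearMap ?_ ?_
  · exact (contDiffAt_chartForm hα x₀ (localPath_mem_target hz)).comp_contDiffWithinAt z h
  · exact h.fderivWithin_right uniqueDiffOn_slab (by simp) (localDomain_subset E (𝓡∂ n) p₀ x₀ hz)

theorem isSmoothForm_tangentForm
    (hf : ContMDiffOn (𝓘(ℝ, ℝ).prod (𝓡∂ n)) 𝓘(ℝ, E) ∞ (uncurry f) (Icc (0 : ℝ) 1 ×ˢ univ))
    {α : DForm 𝓘(ℝ, E) X ℝ (k + 1)} (hα : IsSmoothForm 𝓘(ℝ, E) α) {s : ℝ}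
    (hs : s ∈ Icc (0 : ℝ) 1) : IsSmoothForm (𝓡∂ n) (tangentForm (n := n) f α s) := by
  intro p₀ y hy
  -- Smoothness is local, so the chart of `X` may depend on `y`; it is centred at the image point.
  set x₀ := f s ((extChartAt (𝓡∂ n) p₀).symm y)
  have hz : (s, y) ∈ localDomain E (𝓡∂ n) f p₀ x₀ := mem_localDomain hs hy
  have hmaps : MapsTo (fun x : EuclideanSpace ℝ (Fin n) => (s, x)) (range (𝓡∂ n))
    (Icc (0 : ℝ) 1 ×ˢ range (𝓡∂ n)) := fun x hx => ⟨hs, hx⟩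
  have h1 : ContDiffWithinAt ℝ ∞ (fun x => sliceContraction k (localForm f α p₀ x₀ (s, x)))
      (range (𝓡∂ n)) y :=
    ContDiff.comp_contDiffWithinAt (g := sliceContraction k)
      (by exact (sliceContraction (E := EuclideanSpace ℝ (Fin n)) (F := ℝ) k).contDiff)
      ((contDiffWithinAt_localForm hf hα hz).comp y
        (contDiff_prodMk_right s).contDiffWithinAt hmaps)
  have h2 : ∀ᶠ x in 𝓝[range (𝓡∂ n)] y, (s, x) ∈ localDomain E (𝓡∂ n) f p₀ x₀ :=
    ((contDiff_prodMk_right (𝕜 := ℝ) (n := ∞) s).continuous.continuousWithinAt.tendsto_nhdsWithin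
      hmaps)
      (localDomain_mem_nhdsWithin E (𝓡∂ n) hf p₀ x₀ hz)
  exact (h1.congr_of_eventuallyEq (h2.mono fun x hx => chartForm_tangentForm hf α hx)
    (chartForm_tangentForm hf α hz)).mono (extChartAt_target_subset_range p₀)

theorem extDeriv_chartForm_eq_zero {α : DForm 𝓘(ℝ, E) X ℝ k} (hd : dExt 𝓘(ℝ, E) α = 0) (x : X) :
    extDeriv (chartForm 𝓘(ℝ, E) α x) (extChartAt 𝓘(ℝ, E) x x) = 0 := by
  have : IsManifold 𝓘(ℝ, E) 1 X := .of_le (n := ∞) (by simp)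
  have h := congrFun hd x
  rw [dExt, mfderiv_extChartAt_self, modelWithCornersSelf_coe, range_id, extDerivWithin_univ] at h
  ext v
  exact DFunLike.congr_fun h v

theorem dExt_tangentForm
    (hf : ContMDiffOn (𝓘(ℝ, ℝ).prod (𝓡∂ n)) 𝓘(ℝ, E) ∞ (uncurry f) (Icc (0 : ℝ) 1 ×ˢ univ))
    {α : DForm 𝓘(ℝ, E) X ℝ (k + 1)} (hα : IsSmoothForm 𝓘(ℝ, E) α) (hd : dExt 𝓘(ℝ, E) α = 0)
    (hzero : ∀ t ∈ Icc (0 : ℝ) 1, pullbackForm (𝓡∂ n) 𝓘(ℝ, E) (f t) α = 0) {s : ℝ}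
    (hs : s ∈ Icc (0 : ℝ) 1) : dExt (𝓡∂ n) (tangentForm (n := n) f α s) = 0 := by
  funext p
  set y := extChartAt (𝓡∂ n) p p with hy
  set x₀ := f s p with hx₀
  have hsymm : (extChartAt (𝓡∂ n) p).symm y = p := extChartAt_to_inv p
  have hz : (s, y) ∈ localDomain E (𝓡∂ n) f p x₀ := by
    have := mem_localDomain (E := E) (f := f) hs (mem_extChartAt_target (I := 𝓡∂ n) p)
    rwa [← hy, hsymm] at this
  have hyR : y ∈ range (𝓡∂ n) := mem_range_self _
  have hK := localDomain_subset E (𝓡∂ n) p x₀ hz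
  have hmaps : MapsTo (fun x : EuclideanSpace ℝ (Fin n) => (s, x)) (range (𝓡∂ n))
    (Icc (0 : ℝ) 1 ×ˢ range (𝓡∂ n)) := fun x hx => ⟨hs, hx⟩
  have h2 : ∀ᶠ x in 𝓝[range (𝓡∂ n)] y, (s, x) ∈ localDomain E (𝓡∂ n) f p x₀ :=
    ((contDiff_prodMk_right (𝕜 := ℝ) (n := ∞) s).continuous.continuousWithinAt.tendsto_nhdsWithin
      hmaps)
      (localDomain_mem_nhdsWithin E (𝓡∂ n) hf p x₀ hz)
  have h3 : extDerivWithin (chartForm (𝓡∂ n) (tangentForm (n := n) f α s) p) (range (𝓡∂ n)) y =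
      0 := by
    have e : chartForm (𝓡∂ n) (tangentForm (n := n) f α s) p =ᶠ[𝓝[range (𝓡∂ n)] y]
        fun x => sliceContraction k (localForm f α p x₀ (s, x)) :=
      h2.mono fun x hx => chartForm_tangentForm hf α hx
    rw [e.extDerivWithin_eq_of_mem hyR]
    refine extDerivWithin_sliceContraction (𝓡∂ n).uniqueDiffOn hs hyR
      ((contDiffWithinAt_localForm hf hα hz).differentiableWithinAt (by simp)) ?_ ?_
    -- The chart of `X` is centred at `f s p`, exactly where `dExt` at that point is computed, so no
    -- chart independence of `dExt` is needed.
    · have hG : localPath E (𝓡∂ n) f p x₀ (s, y) = extChartAt 𝓘(ℝ, E) x₀ x₀ := by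
        rw [localPath, hsymm]
      have hβ : DifferentiableWithinAt ℝ (chartForm 𝓘(ℝ, E) α x₀) univ
          (localPath E (𝓡∂ n) f p x₀ (s, y)) :=
        ((contDiffAt_chartForm hα x₀ (localPath_mem_target hz)).differentiableAt
          (by simp)).differentiableWithinAt
      have := extDerivWithin_pullback hβ (contDiffWithinAt_localPath E (𝓡∂ n) hf p x₀ hz)
        (by rw [minSmoothness_of_isRCLikeNormedField]; exact WithTop.coe_le_coe.2 (le_top (a := (2 : ℕ∞))))
        uniqueDiffOn_slab
        (mem_closure_interior_Icc_prod hs ((𝓡∂ n).range_subset_closure_interior hyR)) hK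
        (mapsTo_univ _ _)
      refine this.trans ?_
      rw [extDerivWithin_univ, hG, extDeriv_chartForm_eq_zero hd]
      rfl
    · filter_upwards [localDomain_mem_nhdsWithin E (𝓡∂ n) hf p x₀ hz] with z hz'
      rw [← Prod.mk.eta (p := z)] at hz' ⊢
      rw [← chartForm_pullbackForm hf α hz', hzero _ hz'.1.1]
      rfl
  change (extDerivWithin (chartForm (𝓡∂ n) (tangentForm (n := n) f α s) p)
    (range (𝓡∂ n)) y).compContinuousLinearMap _ = 0
  rw [h3]
  rfl

theorem continuousOn_pullbackForm_apply
    (hf : ContMDiffOn (𝓘(ℝ, ℝ).prod (𝓡∂ n)) 𝓘(ℝ, E) ∞ (uncurry f) (Icc (0 : ℝ) 1 ×ˢ univ))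
    {α : DForm 𝓘(ℝ, E) X ℝ k} (hα : IsSmoothForm 𝓘(ℝ, E) α) (p : L)
    (v : Fin k → TangentSpace (𝓡∂ n) p) :
    ContinuousOn (fun s => pullbackForm (𝓡∂ n) 𝓘(ℝ, E) (f s) α p v) (Icc 0 1) := by
  intro s hs
  set y := extChartAt (𝓡∂ n) p p with hy
  set x₀ := f s p with hx₀
  have hsymm : (extChartAt (𝓡∂ n) p).symm y = p := extChartAt_to_inv p
  have hz : (s, y) ∈ localDomain E (𝓡∂ n) f p x₀ := by
    have := mem_localDomain (E := E) (f := f) hs (mem_extChartAt_target (I := 𝓡∂ n) p)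
    rwa [← hy, hsymm] at this
  have hyR : y ∈ range (𝓡∂ n) := mem_range_self _
  have hmaps : MapsTo (fun r : ℝ => (r, y)) (Icc 0 1) (Icc (0 : ℝ) 1 ×ˢ range (𝓡∂ n)) :=
    fun r hr => ⟨hr, hyR⟩
  have h2 : ∀ᶠ r in 𝓝[Icc 0 1] s, (r, y) ∈ localDomain E (𝓡∂ n) f p x₀ :=
    ((contDiff_prodMk_left (𝕜 := ℝ) (n := ∞) y).continuous.continuousWithinAt.tendsto_nhdsWithin
      hmaps)
      (localDomain_mem_nhdsWithin E (𝓡∂ n) hf p x₀ hz)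
  have h1 : ContinuousWithinAt (fun r => localForm f α p x₀ (r, y) (fun i => (0, v i)))
      (Icc 0 1) s := by
    exact ContinuousWithinAt.comp (f := fun r : ℝ => (r, y))
      (((contDiffWithinAt_localForm hf hα hz).differentiableWithinAt
        (by simp)).continuousAlternatingMap_apply_const _).continuousWithinAt
      (contDiff_prodMk_left (𝕜 := ℝ) (n := ∞) y).continuous.continuousWithinAt hmaps
  have h3 : ∀ r, (r, y) ∈ localDomain E (𝓡∂ n) f p x₀ →
      pullbackForm (𝓡∂ n) 𝓘(ℝ, E) (f r) α p v = localForm f α p x₀ (r, y) (fun i => (0, v i)) := by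
    intro r hr
    have := DFunLike.congr_fun (chartForm_pullbackForm hf α hr) v
    have hL : IsManifold (𝓡∂ n) 1 L := .of_le (n := ∞) (by simp)
    exact (chartForm_self _ p v).symm.trans this
  exact h1.congr_of_eventuallyEq (h2.mono fun r hr => h3 r hr) (h3 s hz)

end LocalForm

/-! ### Real and imaginary parts of a holomorphic form -/

section HolomorphicForm

variable {E : Type*} [NormedAddCommGroup E] [NormedSpace ℂ E]
  {X : Type*} [TopologicalSpace X] [ChartedSpace E X]

theorem isManifold_real [IsManifold 𝓘(ℂ, E) ω X] : IsManifold 𝓘(ℝ, E) ∞ X := by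
  refine isManifold_of_contDiffOn _ _ _ fun e e' he he' => ?_
  have h := (contDiffGroupoid ω 𝓘(ℂ, E)).compatible he he'
  rw [contDiffGroupoid, mem_groupoid_of_pregroupoid] at h
  exact (h.1.restrict_scalars ℝ).of_le le_top

/-- The charts are the same maps over both fields, and a complex derivative is also the real one;
hence taking real or imaginary parts commutes with passing to charts. -/
theorem mfderivWithin_symm_restrictScalars [IsManifold 𝓘(ℂ, E) 1 X] (x : X) {y : E}
    (hy : y ∈ (extChartAt 𝓘(ℂ, E) x).target) :
    (mfderivWithin 𝓘(ℝ, E) 𝓘(ℝ, E) (extChartAt 𝓘(ℝ, E) x).symm (range 𝓘(ℝ, E)) y : E →L[ℝ] E) =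
      ContinuousLinearMap.restrictScalars ℝ (show E →L[ℂ] E from
        mfderivWithin 𝓘(ℂ, E) 𝓘(ℂ, E) (extChartAt 𝓘(ℂ, E) x).symm (range 𝓘(ℂ, E)) y) := by
  have h := (mdifferentiableWithinAt_extChartAt_symm (I := 𝓘(ℂ, E)) hy).hasMFDerivWithinAt
  have hres (u : E → E) (u' : E →L[ℂ] E) (s : Set E) (z : E) (hu : HasFDerivWithinAt u u' s z) :
      HasFDerivWithinAt u (u'.restrictScalars ℝ) s z := hu.restrictScalars ℝ
  let D : E →L[ℝ] E := ContinuousLinearMap.restrictScalars ℝ (show E →L[ℂ] E from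
    mfderivWithin 𝓘(ℂ, E) 𝓘(ℂ, E) (extChartAt 𝓘(ℂ, E) x).symm (range 𝓘(ℂ, E)) y)
  have h2 : HasMFDerivWithinAt 𝓘(ℝ, E) 𝓘(ℝ, E) (extChartAt 𝓘(ℝ, E) x).symm (range 𝓘(ℝ, E)) y D :=
    ⟨h.1, hres _ _ _ _ h.2⟩
  exact h2.mfderivWithin (𝓘(ℝ, E).uniqueMDiffOn _ (by simp))

/-- The imaginary part of a complex alternating form, as a real-linear operation. -/
def imPart (E : Type*) [NormedAddCommGroup E] [NormedSpace ℂ E] (k : ℕ) :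
    (E [⋀^Fin k]→L[ℂ] ℂ) →L[ℝ] (E [⋀^Fin k]→L[ℝ] ℝ) :=
  LinearMap.mkContinuous
    { toFun := fun η => Complex.imCLM.compContinuousAlternatingMap (η.restrictScalars ℝ)
      map_add' := fun _ _ => by ext; simp
      map_smul' := fun _ _ => by ext; simp } 1
    fun η => by
      refine ContinuousAlternatingMap.opNorm_le_bound _ (by positivity) fun v => ?_
      rw [one_mul]
      exact (Complex.abs_im_le_norm _).trans (η.le_opNorm v)

/-- The real part of a complex alternating form, as a real-linear operation. -/
def rePart (E : Type*) [NormedAddCommGroup E] [NormedSpace ℂ E] (k : ℕ) :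
    (E [⋀^Fin k]→L[ℂ] ℂ) →L[ℝ] (E [⋀^Fin k]→L[ℝ] ℝ) :=
  LinearMap.mkContinuous
    { toFun := fun η => Complex.reCLM.compContinuousAlternatingMap (η.restrictScalars ℝ)
      map_add' := fun _ _ => by ext; simp
      map_smul' := fun _ _ => by ext; simp } 1
    fun η => by
      refine ContinuousAlternatingMap.opNorm_le_bound _ (by positivity) fun v => ?_
      rw [one_mul]
      exact (Complex.abs_re_le_norm _).trans (η.le_opNorm v)

variable {k : ℕ} {Ω : DForm 𝓘(ℂ, E) X ℂ k}

theorem chartForm_imForm [IsManifold 𝓘(ℂ, E) 1 X] (x : X) {y : E}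
    (hy : y ∈ (extChartAt 𝓘(ℂ, E) x).target) :
    chartForm 𝓘(ℝ, E) (imForm Ω) x y = imPart E k (chartForm 𝓘(ℂ, E) Ω x y) := by
  rw [chartForm, mfderivWithin_symm_restrictScalars x hy]
  rfl

theorem chartForm_reForm [IsManifold 𝓘(ℂ, E) 1 X] (x : X) {y : E}
    (hy : y ∈ (extChartAt 𝓘(ℂ, E) x).target) :
    chartForm 𝓘(ℝ, E) (reForm Ω) x y = rePart E k (chartForm 𝓘(ℂ, E) Ω x y) := by
  rw [chartForm, mfderivWithin_symm_restrictScalars x hy]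
  rfl

theorem isSmoothForm_imForm [IsManifold 𝓘(ℂ, E) 1 X] (hΩ : IsSmoothForm 𝓘(ℂ, E) Ω) :
    IsSmoothForm 𝓘(ℝ, E) (imForm Ω) := fun x =>
  ((imPart E k).contDiff.comp_contDiffOn ((hΩ x).restrict_scalars ℝ)).congr
    fun _ hy => chartForm_imForm x hy

theorem isSmoothForm_reForm [IsManifold 𝓘(ℂ, E) 1 X] (hΩ : IsSmoothForm 𝓘(ℂ, E) Ω) :
    IsSmoothForm 𝓘(ℝ, E) (reForm Ω) := fun x =>
  ((rePart E k).contDiff.comp_contDiffOn ((hΩ x).restrict_scalars ℝ)).congr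
    fun _ hy => chartForm_reForm x hy

theorem extDeriv_imPart {β : E → E [⋀^Fin k]→L[ℂ] ℂ} {y : E} (hβ : DifferentiableAt ℂ β y)
    (v : Fin (k + 1) → E) :
    extDeriv (fun x => imPart E k (β x)) y v = (extDeriv β y v).im := by
  have h1 : DifferentiableAt ℝ (fun x => imPart E k (β x)) y :=
    DifferentiableAt.comp (g := imPart E k) y (by exact (imPart E k).differentiableAt)
      (hβ.restrictScalars ℝ)
  rw [extDeriv_apply h1, extDeriv_apply hβ, Complex.im_sum]
  refine Finset.sum_congr rfl fun i _ => ?_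
  have h2 : HasFDerivAt (fun x => imPart E k (β x) (i.removeNth v))
      (Complex.imCLM.comp ((fderiv ℂ (fun x => β x (i.removeNth v)) y).restrictScalars ℝ)) y :=
    Complex.imCLM.hasFDerivAt.comp y
      ((hβ.continuousAlternatingMap_apply_const _).hasFDerivAt.restrictScalars ℝ)
  rw [h2.fderiv]
  rcases Nat.even_or_odd (i : ℕ) with h | h <;> simp [h.neg_one_pow]

/-- In a chart `d` commutes with `Im`, and the derivative of `Ω` is complex-alternating of degree `k
+ 1` on a space of complex dimension `k`, where any `k + 1` vectors are dependent. -/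
theorem dExt_imForm [IsManifold 𝓘(ℂ, E) 1 X] [FiniteDimensional ℂ E]
    (hn : Module.finrank ℂ E = k) (hΩ : IsSmoothForm 𝓘(ℂ, E) Ω) :
    dExt 𝓘(ℝ, E) (imForm Ω) = 0 := by
  funext x
  have hy : extChartAt 𝓘(ℂ, E) x x ∈ (extChartAt 𝓘(ℂ, E) x).target := mem_extChartAt_target x
  have hnhds := (isOpen_extChartAt_target (I := 𝓘(ℂ, E)) x).mem_nhds hy
  have e : chartForm 𝓘(ℝ, E) (imForm Ω) x =ᶠ[𝓝 (extChartAt 𝓘(ℂ, E) x x)]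
      fun y => imPart E k (chartForm 𝓘(ℂ, E) Ω x y) :=
    Filter.eventuallyEq_of_mem hnhds fun y hy => chartForm_imForm x hy
  have h : extDerivWithin (chartForm 𝓘(ℝ, E) (imForm Ω) x) (range 𝓘(ℝ, E))
      (extChartAt 𝓘(ℝ, E) x x) = 0 := by
    rw [modelWithCornersSelf_coe, range_id, extDerivWithin_univ]
    refine e.extDeriv_eq.trans ?_
    ext v
    rw [extDeriv_imPart (((hΩ x).contDiffAt hnhds).differentiableAt (by simp))]
    have : extDeriv (chartForm 𝓘(ℂ, E) Ω x) (extChartAt 𝓘(ℂ, E) x x) v = 0 := by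
      refine AlternatingMap.map_linearDependent (extDeriv (chartForm 𝓘(ℂ, E) Ω x)
        (extChartAt 𝓘(ℂ, E) x x)).toAlternatingMap v fun hv => ?_
      have := hv.fintype_card_le_finrank
      simp [hn] at this
    rw [this]
    rfl
  change (extDerivWithin (chartForm 𝓘(ℝ, E) (imForm Ω) x) (range 𝓘(ℝ, E))
      (extChartAt 𝓘(ℝ, E) x x)).compContinuousLinearMap _ = 0
  rw [h]
  rfl

end HolomorphicForm

/-! ### Curves in embedded submanifolds -/

section Tangency

variable {E₁ : Type*} [NormedAddCommGroup E₁] [NormedSpace ℝ E₁]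
  {H₁ : Type*} [TopologicalSpace H₁] {I₁ : ModelWithCorners ℝ E₁ H₁} [I₁.Boundaryless]
  {N : Type*} [TopologicalSpace N] [ChartedSpace H₁ N]
  {E : Type*} [NormedAddCommGroup E] [NormedSpace ℝ E]
  {H : Type*} [TopologicalSpace H] {I : ModelWithCorners ℝ E H}
  {X : Type*} [TopologicalSpace X] [ChartedSpace H X] {ι : N → X}

/-- An immersion has a local differentiable left inverse. -/
theorem exists_leftInverse_of_isImmersionAt {y : N} (hι : Manifold.IsImmersionAt I₁ I ∞ ι y)
    [IsManifold I₁ ∞ N] [IsManifold I ∞ X] :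
    ∃ (r : X → N) (U : Set N), IsOpen U ∧ y ∈ U ∧ MDifferentiableAt I I₁ r (ι y) ∧
      ∀ z ∈ U, r (ι z) = z := by
  have hφ := hι.domChart_mem_maximalAtlas
  have hψ := hι.codChart_mem_maximalAtlas
  have hr : ∀ z ∈ hι.domChart.source,
      hι.equiv.symm (hι.codChart.extend I (ι z)) = (hι.domChart.extend I₁ z, 0) := by
    intro z hz
    have h1 := hι.writtenInCharts ((hι.domChart.extend I₁).map_source
      (by rwa [OpenPartialHomeomorph.extend_source]))
    simp only [comp_apply] at h1
    rw [(hι.domChart.extend I₁).left_inv (by rwa [OpenPartialHomeomorph.extend_source])] at h1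
    rw [h1, ContinuousLinearEquiv.symm_apply_apply]
  -- In immersion charts `ι` reads `z ↦ (z, 0)`, so projection to the first factor inverts it.
  refine ⟨fun x => (hι.domChart.extend I₁).symm (hι.equiv.symm (hι.codChart.extend I x)).1,
    hι.domChart.source, hι.domChart.open_source, hι.mem_domChart_source, ?_, ?_⟩
  · have h1 : MDifferentiableAt I 𝓘(ℝ, E) (hι.codChart.extend I) (ι y) :=
      ((hι.codChart.contMDiffOn_extend hψ).contMDiffAt
        (hι.codChart.open_source.mem_nhds hι.mem_codChart_source)).mdifferentiableAt (by simp)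
    have h2 : MDifferentiableAt 𝓘(ℝ, E) 𝓘(ℝ, E₁) (fun v => (hι.equiv.symm v).1)
        (hι.codChart.extend I (ι y)) :=
      (((ContinuousLinearMap.fst ℝ E₁ hι.complement).comp
        (hι.equiv.symm : E →L[ℝ] E₁ × hι.complement)).differentiableAt).mdifferentiableAt
    have h3 : MDifferentiableAt 𝓘(ℝ, E₁) I₁ (hι.domChart.extend I₁).symm
        (hι.equiv.symm (hι.codChart.extend I (ι y))).1 := by
      rw [hr y hι.mem_domChart_source]
      refine ((contMDiffOn_extend_symm hφ).contMDiffAt ?_).mdifferentiableAt (by simp)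
      have h4 : I₁ '' hι.domChart.target = (hι.domChart.extend I₁).target := by
        rw [OpenPartialHomeomorph.extend_target, I₁.image_eq, I₁.range_eq_univ, inter_univ]
      rw [h4]
      refine (hι.domChart.isOpen_extend_target).mem_nhds ((hι.domChart.extend I₁).map_source ?_)
      rw [OpenPartialHomeomorph.extend_source]
      exact hι.mem_domChart_source
    exact h3.comp (ι y) (h2.comp (ι y) h1)
  · intro z hz
    simp only [hr z hz]
    exact (hι.domChart.extend I₁).left_inv (by rwa [OpenPartialHomeomorph.extend_source])

/-- The velocity of a curve in an embedded submanifold is tangent to the submanifold. -/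
theorem mfderivWithin_mem_range_of_isSmoothEmbedding [IsManifold I₁ ∞ N] [IsManifold I ∞ X]
    (hι : Manifold.IsSmoothEmbedding I₁ I ∞ ι) {c : ℝ → X} {S : Set ℝ} {t₀ : ℝ}
    (hS : UniqueDiffWithinAt ℝ S t₀)
    (hc : MDifferentiableWithinAt 𝓘(ℝ, ℝ) I c S t₀)
    (hcι : ∀ᶠ s in 𝓝[S] t₀, c s ∈ range ι) {y : N} (hy : ι y = c t₀) :
    ∃ w : E₁, (mfderivWithin 𝓘(ℝ, ℝ) I c S t₀ (1 : ℝ) : E) = mfderiv I₁ I ι y w := by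
  have hy' := hι.isImmersion.isImmersionAt y
  obtain ⟨r, U, hU, hyU, hr, hrU⟩ := exists_leftInverse_of_isImmersionAt hy'
  obtain ⟨V, hV, hVU⟩ := hι.isEmbedding.isInducing.isOpen_iff.1 hU
  -- The left inverse works only on `U`. Because `ι` is a topological embedding, points of its range
  -- close to `ι y` come from `U`.
  have hev : ∀ᶠ s in 𝓝[S] t₀, c s = ι (r (c s)) := by
    have h1 : ∀ᶠ s in 𝓝[S] t₀, c s ∈ V :=
      hc.continuousWithinAt (hV.mem_nhds (by rw [← hy]; rw [← hVU] at hyU; exact hyU))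
    filter_upwards [hcι, h1] with s hs hsV
    obtain ⟨z, hz⟩ := hs
    rw [← hz, hrU z (by rw [← hVU, mem_preimage, hz]; exact hsV)]
  have hry : r (c t₀) = y := by rw [← hy, hrU y hyU]
  rw [hy] at hr
  have hι' : MDifferentiableAt I₁ I ι (r (c t₀)) := by
    rw [hry]; exact hy'.contMDiffAt.mdifferentiableAt (by simp)
  have h2 := hι'.hasMFDerivAt.comp_hasMFDerivWithinAt t₀
    (hr.hasMFDerivAt.comp_hasMFDerivWithinAt t₀ hc.hasMFDerivWithinAt)
  have h3 := h2.congr_of_eventuallyEq hev (by rw [comp_apply, comp_apply, hry, hy])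
  have h4 := h3.mfderivWithin hS.uniqueMDiffWithinAt
  rw [h4]
  let D : N → E₁ →L[ℝ] E := fun z => mfderiv I₁ I ι z
  have hD : D (r (c t₀)) = D y := congrArg D hry
  exact ⟨mfderiv I I₁ r (c t₀) (mfderivWithin 𝓘(ℝ, ℝ) I c S t₀ (1 : ℝ)),
    congrArg (fun A : E₁ →L[ℝ] E => A (mfderiv I I₁ r (c t₀)
      (mfderivWithin 𝓘(ℝ, ℝ) I c S t₀ (1 : ℝ)))) hD⟩

end Tangency

/-! ### Boundary tangent vectors and the Lagrangian boundary condition -/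

section Boundary

variable {n : ℕ} [NeZero n] {L : Type*} [TopologicalSpace L] [ChartedSpace (EuclideanHalfSpace n) L]

theorem mem_boundaryTangent_iff [IsManifold (𝓡∂ n) 1 L] {p : L} {v : TangentSpace (𝓡∂ n) p} :
    v ∈ boundaryTangent p ↔ (show EuclideanSpace ℝ (Fin n) from v) 0 = 0 := by
  rw [boundaryTangent, mem_ofPred, mfderiv_extChartAt_self]
  rfl

theorem extChartAt_symm_mem_boundary [IsManifold (𝓡∂ n) 1 L] {p : L}
    {z : EuclideanSpace ℝ (Fin n)} (hz : z ∈ (extChartAt (𝓡∂ n) p).target) (h0 : 0 = z 0) :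
    (extChartAt (𝓡∂ n) p).symm z ∈ (𝓡∂ n).boundary L := by
  have hq : (extChartAt (𝓡∂ n) p).symm z ∈ (chartAt (EuclideanHalfSpace n) p).source := by
    rw [← extChartAt_source (𝓡∂ n)]
    exact (extChartAt (𝓡∂ n) p).map_target hz
  refine ((𝓡∂ n).isBoundaryPoint_iff_of_mem_atlas one_ne_zero (chart_mem_atlas _ p) hq).2 ?_
  change extChartAt (𝓡∂ n) p ((extChartAt (𝓡∂ n) p).symm z) ∈
    frontier (extChartAt (𝓡∂ n) p).target
  rw [(extChartAt (𝓡∂ n) p).right_inv hz]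
  refine ⟨subset_closure hz, fun h => ?_⟩
  have h1 : z ∈ frontier (range (𝓡∂ n)) := by
    rw [frontier_range_modelWithCornersEuclideanHalfSpace]
    exact h0
  exact h1.2 (interior_mono (extChartAt_target_subset_range p) h)

/-- Vectors tangent to the boundary are velocities of curves in the boundary. -/
theorem exists_curve_of_mem_boundaryTangent [IsManifold (𝓡∂ n) 1 L] {p : L}
    (hp : p ∈ (𝓡∂ n).boundary L) {v : TangentSpace (𝓡∂ n) p} (hv : v ∈ boundaryTangent p) :
    ∃ c : ℝ → L, c 0 = p ∧
      (∀ᶠ r in 𝓝 0, c r ∈ connectedComponentIn ((𝓡∂ n).boundary L) p) ∧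
      MDifferentiableAt 𝓘(ℝ, ℝ) (𝓡∂ n) c 0 ∧
      (mfderiv 𝓘(ℝ, ℝ) (𝓡∂ n) c 0 (1 : ℝ) : EuclideanSpace ℝ (Fin n)) = v := by
  let v' : EuclideanSpace ℝ (Fin n) := v
  have hv0 : v' 0 = 0 := mem_boundaryTangent_iff.1 hv
  set y := extChartAt (𝓡∂ n) p p with hy
  have hy0 : 0 = y 0 := by
    have h : y ∈ frontier (range (𝓡∂ n)) := hp
    rwa [frontier_range_modelWithCornersEuclideanHalfSpace] at h
  -- In the chart at `p` the curve is a straight line; it stays in the boundary hyperplane because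
  -- `y` and `v'` both have zero normal coordinate.
  let ℓ : ℝ → EuclideanSpace ℝ (Fin n) := fun r => y + r • v'
  have hℓ0 : ℓ 0 = y := by simp [ℓ]
  have hℓz (r : ℝ) : 0 = ℓ r 0 := by
    simp [ℓ, hv0, ← hy0]
  have hℓr (r : ℝ) : ℓ r ∈ range (𝓡∂ n) := by
    rw [range_modelWithCornersEuclideanHalfSpace]
    exact (hℓz r).le
  have hℓc : Continuous ℓ := by fun_prop
  have hℓd : HasFDerivAt ℓ (ContinuousLinearMap.toSpanSingleton ℝ v') 0 := by
    have h := ((hasDerivAt_id (0 : ℝ)).smul_const v').const_add y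
    rw [one_smul] at h
    exact h.hasFDerivAt
  have htarget : ∀ᶠ r in 𝓝 0, ℓ r ∈ (extChartAt (𝓡∂ n) p).target := by
    have h1 : (extChartAt (𝓡∂ n) p).target ∈ 𝓝[range (𝓡∂ n)] (ℓ 0) := by
      rw [hℓ0]; exact extChartAt_target_mem_nhdsWithin p
    have h2 : Filter.Tendsto ℓ (𝓝 0) (𝓝[range (𝓡∂ n)] (ℓ 0)) :=
      tendsto_nhdsWithin_iff.2 ⟨hℓc.continuousAt, Filter.Eventually.of_forall hℓr⟩
    exact h2 h1
  have hd := (mdifferentiableWithinAt_extChartAt_symm (I := 𝓡∂ n)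
    (mem_extChartAt_target (I := 𝓡∂ n) p)).hasMFDerivWithinAt
  rw [mfderivWithin_range_extChartAt_symm, ← hy, ← hℓ0] at hd
  have hcomp : HasMFDerivAt 𝓘(ℝ, ℝ) (𝓡∂ n) (fun r => (extChartAt (𝓡∂ n) p).symm (ℓ r)) 0
      (ContinuousLinearMap.toSpanSingleton ℝ v') := by
    have h := hd.comp (0 : ℝ) (s := univ) hℓd.hasMFDerivAt.hasMFDerivWithinAt fun r _ => hℓr r
    exact hasMFDerivWithinAt_univ.1 h
  refine ⟨fun r => (extChartAt (𝓡∂ n) p).symm (ℓ r), ?_, ?_, hcomp.mdifferentiableAt, ?_⟩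
  · simp only [hℓ0, hy, extChartAt_to_inv]
  -- The image of a small interval is a connected subset of the boundary through `p`, so it stays in
  -- the component carrying the boundary condition at `p`.
  · obtain ⟨ε, hε, hball⟩ := Metric.eventually_nhds_iff_ball.1 htarget
    filter_upwards [Metric.ball_mem_nhds 0 hε] with r hr
    have hpre : IsPreconnected ((fun r => (extChartAt (𝓡∂ n) p).symm (ℓ r)) '' Metric.ball 0 ε) :=
      (convex_ball (0 : ℝ) ε).isPreconnected.image _
        ((continuousOn_extChartAt_symm p).comp hℓc.continuousOn hball)
    refine hpre.subset_connectedComponentIn ⟨0, Metric.mem_ball_self hε, ?_⟩ ?_ ⟨r, hr, rfl⟩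
    · simp only [hℓ0, hy, extChartAt_to_inv]
    · rintro _ ⟨s, hs, rfl⟩
      exact extChartAt_symm_mem_boundary (hball s hs) (hℓz s)
  · rw [hcomp.mfderiv]
    exact ContinuousLinearMap.toSpanSingleton_apply_one ℝ v'

end Boundary

section BoundaryConditions

variable {E : Type*} [NormedAddCommGroup E] [NormedSpace ℂ E]
  {X : Type*} [TopologicalSpace X] [ChartedSpace E X] [IsManifold 𝓘(ℝ, E) ∞ X]
  {n : ℕ} [NeZero n] {L : Type*} [TopologicalSpace L] [ChartedSpace (EuclideanHalfSpace n) L]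
  [IsManifold (𝓡∂ n) ∞ L] {d : ℕ} {C : Fin d → Set L} {Λ : Fin d → Type*}
  [∀ i, TopologicalSpace (Λ i)] [∀ i, ChartedSpace (EuclideanSpace ℝ (Fin n)) (Λ i)]
  [∀ i, IsManifold (𝓡 n) ∞ (Λ i)] {ι : ∀ i, Λ i → X} {Y : CalabiYau E X n} {f : ℝ → L → X}

/-- The path `s ↦ f s p` and the images under `f t` of boundary curves through `p` all lie in the
same Lagrangian. Both arguments of `ω` are therefore tangent to it. -/
theorem vanishesOnBoundary_tangentForm (hC : IsBoundaryComponents (n := n) C)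
    (hι : ∀ i, Y.IsEmbeddedLagrangian (ι i))
    (hf : ContMDiffOn (𝓘(ℝ, ℝ).prod (𝓡∂ n)) 𝓘(ℝ, E) ∞ (uncurry f) (Icc (0 : ℝ) 1 ×ˢ univ))
    (hsl : ∀ t ∈ Icc (0 : ℝ) 1, Y.IsSpecialLagrangianImmersion (f t))
    (hbc : ∀ t ∈ Icc (0 : ℝ) 1, HasBoundaryConditions (E := E) (n := n) C ι (f t)) {t : ℝ}
    (ht : t ∈ Icc (0 : ℝ) 1) : VanishesOnBoundary (tangentForm (n := n) f Y.kahler t) := by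
  have : IsManifold (𝓡∂ n) 1 L := .of_le (n := ∞) (by simp)
  intro p hp v hv
  obtain ⟨i, hi⟩ : ∃ i, C i = connectedComponentIn ((𝓡∂ n).boundary L) p := by
    have h : connectedComponentIn ((𝓡∂ n).boundary L) p ∈ range C := by
      rw [hC.range_eq]
      exact ⟨p, hp, rfl⟩
    exact h
  have hmem {s : ℝ} (hs : s ∈ Icc (0 : ℝ) 1) {q : L}
      (hq : q ∈ connectedComponentIn ((𝓡∂ n).boundary L) p) : f s q ∈ range (ι i) :=
    (hbc s hs).maps i ⟨q, hi ▸ hq, rfl⟩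
  have hpp := mem_connectedComponentIn hp
  obtain ⟨y, hy⟩ := hmem ht hpp
  obtain ⟨w₁, hw₁⟩ := mfderivWithin_mem_range_of_isSmoothEmbedding (hι i).embedding
    (c := fun s => f s p) (uniqueDiffOn_Icc zero_lt_one t ht)
    ((hf.comp (contMDiff_id.prodMk contMDiff_const).contMDiffOn
      fun s hs => ⟨hs, mem_univ p⟩ : ContMDiffOn 𝓘(ℝ, ℝ) 𝓘(ℝ, E) ∞ (fun s => f s p)
        (Icc 0 1)).mdifferentiableOn (by simp) t ht)
    (Filter.eventually_of_mem self_mem_nhdsWithin fun s hs => hmem hs hpp) hy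
  obtain ⟨c, hc0, hcC, hcd, hcv⟩ := exists_curve_of_mem_boundaryTangent hp (hv 0)
  have hfd : MDifferentiableAt (𝓡∂ n) 𝓘(ℝ, E) (f t) (c 0) :=
    (hsl t ht).smooth.mdifferentiableAt (by simp)
  obtain ⟨w₂, hw₂⟩ := mfderivWithin_mem_range_of_isSmoothEmbedding (hι i).embedding
    (c := f t ∘ c) (t₀ := 0) uniqueDiffWithinAt_univ (hfd.comp (0 : ℝ) hcd).mdifferentiableWithinAt
    (by rw [nhdsWithin_univ]; exact hcC.mono fun r hr => hmem ht hr)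
    (by rw [comp_apply, hc0]; exact hy)
  rw [mfderivWithin_univ, mfderiv_comp (0 : ℝ) hfd hcd] at hw₂
  let D : L → EuclideanSpace ℝ (Fin n) →L[ℝ] E := fun q => mfderiv (𝓡∂ n) 𝓘(ℝ, E) (f t) q
  have hD : D (c 0) (mfderiv 𝓘(ℝ, ℝ) (𝓡∂ n) c 0 (1 : ℝ)) = D p (v 0) := by
    rw [hcv, hc0]
  have hw₃ : D p (v 0) = mfderiv (𝓡 n) 𝓘(ℝ, E) (ι i) y w₂ := hD.symm.trans hw₂
  let β : X → E [⋀^Fin 2]→L[ℝ] ℝ := Y.kahler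
  let B : E →L[ℝ] E := ContinuousLinearMap.id ℝ E
  have h1 : tangentForm (n := n) f Y.kahler t p v = β (f t p)
      (Matrix.vecCons (velocity f t p) fun i => D p (v i)) := rfl
  have h2 : (fun i => D p (v i)) = fun _ : Fin 1 => D p (v 0) := by
    funext j; rw [Subsingleton.elim j 0]
  have h3 := DFunLike.congr_fun (congrFun (hι i).lagrangian y) ![w₁, w₂]
  rw [h1, h2, hw₃, ← hy]
  have h4 : (Matrix.vecCons (velocity f t p) fun _ : Fin 1 => mfderiv (𝓡 n) 𝓘(ℝ, E) (ι i) y w₂ :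
      Fin 2 → E) = fun j => mfderiv (𝓡 n) 𝓘(ℝ, E) (ι i) y (![w₁, w₂] j) := by
    funext j
    refine Fin.cases ?_ (fun j => ?_) j
    · exact hw₁
    · rw [Subsingleton.elim j 0]; rfl
  exact (congrArg (β (ι i y)) h4).trans h3

end BoundaryConditions

/-! ### Harmonic fields and Hodge duality -/

section HarmonicFields

variable {E : Type*} [NormedAddCommGroup E] [NormedSpace ℝ E]
  {H : Type*} [TopologicalSpace H] {I : ModelWithCorners ℝ E H}
  {M : Type*} [TopologicalSpace M] [ChartedSpace H M] {n k : ℕ}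
  (g : ∀ p : M, TangentSpace I p → TangentSpace I p → ℝ) (μ : DForm I M ℝ n)

theorem dExt_const_smul (c : ℝ) (α : DForm I M ℝ k) : dExt I (c • α) = c • dExt I α := by
  funext x
  have h1 : chartForm I (c • α) x = c • chartForm I α x := rfl
  have h2 := extDerivWithin_smul c (chartForm I α x)
    (I.uniqueDiffOn _ (mem_range_self (chartAt H x x)) : UniqueDiffWithinAt ℝ (range I)
      (extChartAt I x x))
  rw [dExt, h1]
  exact congrArg (fun β : E [⋀^Fin (k + 1)]→L[ℝ] ℝ =>
    β.compContinuousLinearMap (mfderiv I 𝓘(ℝ, E) (extChartAt I x) x : E →L[ℝ] E)) h2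

theorem dExt_zero : dExt I (0 : DForm I M ℝ k) = 0 := by
  rw [← zero_smul ℝ (0 : DForm I M ℝ k), dExt_const_smul, zero_smul]

theorem hodgeStar_zero {l : ℕ} (h : l + k = n) : hodgeStar g μ h (0 : DForm I M ℝ k) = 0 := by
  funext p
  rw [hodgeStar, Finset.sum_eq_zero fun i _ => ?_, smul_zero]
  · rfl
  · exact zero_smul ℝ _

/-- Quantifying over `l` avoids the truncated subtraction in `codiff`; in degrees above `n` the
codifferential is zero by definition. -/
theorem codiff_eq_zero_of_dExt_hodgeStar {α : DForm I M ℝ (k + 1)}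
    (h : ∀ l (hl : l + (k + 1) = n), dExt I (hodgeStar g μ hl α) = 0) : codiff g μ k α = 0 := by
  rw [codiff]
  split_ifs
  · rw [h, hodgeStar_zero, smul_zero]
  · rfl

theorem codiff_zero : codiff g μ k (0 : DForm I M ℝ (k + 1)) = 0 :=
  codiff_eq_zero_of_dExt_hodgeStar g μ fun l hl => by rw [hodgeStar_zero, dExt_zero]

variable {g μ}

theorem IsHarmonicField.of_closed_of_coclosed {α : DForm I M ℝ k} (hs : IsSmoothForm I α)
    (hd : dExt I α = 0) (hc : IsCoclosed g μ k α) : IsHarmonicField g μ α := by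
  refine ⟨hs, ?_, hd, hc⟩
  cases k with
  | zero => rw [laplacian, hd, codiff_zero]
  | succ k =>
    have hc' : codiff g μ k α = 0 := hc
    rw [laplacian, hd, hc', dExt_zero, codiff_zero, add_zero]

end HarmonicFields

section Duality

variable {E : Type*} [NormedAddCommGroup E] [NormedSpace ℝ E]
  {H : Type*} [TopologicalSpace H] {I : ModelWithCorners ℝ E H}
  {M : Type*} [TopologicalSpace M] [ChartedSpace H M] {m : ℕ}
  {g : ∀ p : M, TangentSpace I p → TangentSpace I p → ℝ} {μ : DForm I M ℝ (m + 1)} {p : M}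

theorem exists_basis_eq_orientedFrame (hn : Module.finrank ℝ (TangentSpace I p) = m + 1)
    (G : TangentSpace I p →ₗ[ℝ] TangentSpace I p →ₗ[ℝ] ℝ) (hg : ∀ v w, g p v w = G v w)
    (h : ∃ e, IsOrientedFrame g μ p e) :
    ∃ b : Module.Basis (Fin (m + 1)) ℝ (TangentSpace I p), ⇑b = orientedFrame g μ p ∧
      (∀ v i, b.repr v i = G v (b i)) ∧ 0 < μ p b := by
  have hf := orientedFrame_spec g μ h
  obtain ⟨b, hb, hr⟩ := exists_basis_of_orthonormal hn G _ fun i j => (hg _ _).symm.trans (hf.1 i j)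
  exact ⟨b, hb, by rwa [hb], by rw [hb]; exact hf.2⟩

/-- The Hodge star of the `1`-form dual to `w` is the contraction of the volume form with `w`. -/
theorem hodgeStar_apply_of_dual (hn : Module.finrank ℝ (TangentSpace I p) = m + 1)
    (G : TangentSpace I p →ₗ[ℝ] TangentSpace I p →ₗ[ℝ] ℝ) (hg : ∀ v w, g p v w = G v w)
    (h : ∃ e, IsOrientedFrame g μ p e) {θ : DForm I M ℝ 1} {w : TangentSpace I p}
    (hθ : ∀ v, θ p v = G w (v 0)) (v : Fin m → TangentSpace I p) :
    hodgeStar g μ (k := 1) (l := m) rfl θ p v = volForm g μ p (Fin.cons w v) := by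
  obtain ⟨b, hb, hr, -⟩ := exists_basis_eq_orientedFrame hn G hg h
  have hw : ∑ a, θ p (fun _ => orientedFrame g μ p a) • orientedFrame g μ p a = w := by
    conv_rhs => rw [← b.sum_repr w]
    refine Finset.sum_congr rfl fun a _ => ?_
    rw [hθ, hr, hb]
  rw [hodgeStar_one_apply, hw]

/-- The Hodge star of the contraction of the volume form with `w` is dual to `w` up to sign. -/
theorem hodgeStar_apply_of_contraction (hn : Module.finrank ℝ (TangentSpace I p) = m + 1)
    (G : TangentSpace I p →ₗ[ℝ] TangentSpace I p →ₗ[ℝ] ℝ) (hg : ∀ v w, g p v w = G v w)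
    (h : ∃ e, IsOrientedFrame g μ p e) (h1 : 1 + m = m + 1) {φ : DForm I M ℝ m}
    {w : TangentSpace I p} (hφ : ∀ u, φ p u = volForm g μ p (Fin.cons w u))
    (v : Fin 1 → TangentSpace I p) :
    hodgeStar g μ (k := m) (l := 1) h1 φ p v =
      ((Equiv.Perm.sign (finRotate (m + 1)) : ℤ) : ℝ) * G w (v 0) := by
  obtain ⟨b, hb, hr, hpos⟩ := exists_basis_eq_orientedFrame hn G hg h
  rw [hodgeStar_contraction_apply g μ h1 φ b hb hpos.ne' w hφ]
  congr 1
  conv_rhs => rw [← b.sum_repr (v 0)]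
  rw [map_sum]
  refine Finset.sum_congr rfl fun a _ => ?_
  rw [map_smul, smul_eq_mul, hr w, mul_comm]

end Duality

theorem apply_cons_neg {V : Type*} [AddCommGroup V] [Module ℝ V] [TopologicalSpace V] {m : ℕ}
    (ν : V [⋀^Fin (m + 1)]→L[ℝ] ℝ) (u : V) (v : Fin m → V) :
    ν (Fin.cons (-u) v) = -ν (Fin.cons u v) := by
  have h := ν.toAlternatingMap.map_update_neg (Fin.cons u v) 0 u
  rwa [Fin.update_cons_zero, Fin.update_cons_zero] at h

/-! ### Calibration and the normal component of the velocity -/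

section SpecialLagrangian

theorem abs_re_apply_eq_one {V : Type*} [NormedAddCommGroup V] [NormedSpace ℂ V]
    {T : Type*} [AddCommGroup T] [Module ℝ T] {n : ℕ} [NeZero n]
    (hn : Module.finrank ℂ V = n) (κ : V [⋀^Fin 2]→L[ℝ] ℝ) (Ω : V [⋀^Fin n]→L[ℂ] ℂ)
    (hJ : ∀ v w, κ ![Complex.I • v, Complex.I • w] = κ ![v, w])
    (hvol : ∀ v : Fin (2 * n) → V, (-1 : ℂ) ^ (n * (n - 1) / 2) * (Complex.I / 2) ^ n *
        wedge (Ω.restrictScalars ℝ).toAlternatingMap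
          (Complex.conjCLE.toLinearMap.compAlternatingMap (Ω.restrictScalars ℝ).toAlternatingMap)
          (fun i => v (Fin.cast (by omega) i)) =
      ((n.factorial : ℂ)⁻¹) *
        wedgePow (Complex.ofRealCLM.toLinearMap.compAlternatingMap κ.toAlternatingMap) n v)
    (A : T →ₗ[ℝ] V) (hκ : ∀ v w, κ ![A v, A w] = 0) (hΩ : ∀ v : Fin n → T, (Ω (A ∘ v)).im = 0)
    (e : Fin n → T) (he : ∀ i j, inducedMetric κ A (e i) (e j) = if i = j then 1 else 0) :
    |(Ω (A ∘ e)).re| = 1 := by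
  rw [Complex.abs_re_eq_norm.2 (hΩ e)]
  exact norm_apply_of_unitary hn κ Ω hJ hvol (A ∘ e) (fun i j => hκ _ _) he

variable {E : Type*} [NormedAddCommGroup E] [NormedSpace ℂ E]
  {X : Type*} [TopologicalSpace X] [ChartedSpace E X]
  {m : ℕ} {L : Type*} [TopologicalSpace L] [ChartedSpace (EuclideanHalfSpace (m + 1)) L]
  {Y : CalabiYau E X (m + 1)} {f : L → X}

theorem finrank_tangentSpace_halfSpace (p : L) :
    Module.finrank ℝ (TangentSpace (𝓡∂ (m + 1)) p) = m + 1 :=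
  finrank_euclideanSpace_fin

variable (Y f) in
/-- The pullback metric as a bilinear form. -/
def pullbackBilin (p : L) :
    TangentSpace (𝓡∂ (m + 1)) p →ₗ[ℝ] TangentSpace (𝓡∂ (m + 1)) p →ₗ[ℝ] ℝ :=
  inducedMetric (V := E) (Y.kahler (f p)) (mfderiv (𝓡∂ (m + 1)) 𝓘(ℝ, E) f p).toLinearMap

theorem pullbackBilin_symm (p : L) (v w : TangentSpace (𝓡∂ (m + 1)) p) :
    pullbackBilin Y f p v w = pullbackBilin Y f p w v :=
  inducedMetric_symm (V := E) _ (Y.invariant_kahler (f p)) _ v w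

theorem CalabiYau.IsSpecialLagrangianImmersion.pullbackBilin_pos
    (h : Y.IsSpecialLagrangianImmersion f) (p : L) (v : TangentSpace (𝓡∂ (m + 1)) p)
    (hv : v ≠ 0) : 0 < pullbackBilin Y f p v v :=
  inducedMetric_pos (V := E) _ (Y.positive_kahler (f p)) _ (h.injective p) v hv

theorem CalabiYau.IsSpecialLagrangianImmersion.kahler_apply
    (h : Y.IsSpecialLagrangianImmersion f) (p : L) (v w : TangentSpace (𝓡∂ (m + 1)) p) :
    (Y.kahler (f p) : E [⋀^Fin 2]→L[ℝ] ℝ) ![(mfderiv (𝓡∂ (m + 1)) 𝓘(ℝ, E) f p v : E),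
      (mfderiv (𝓡∂ (m + 1)) 𝓘(ℝ, E) f p w : E)] = 0 := by
  have h1 := DFunLike.congr_fun (congrFun h.lagrangian p) ![v, w]
  refine Eq.trans (congrArg (Y.kahler (f p) : E [⋀^Fin 2]→L[ℝ] ℝ) ?_) h1
  funext j
  fin_cases j <;> rfl

theorem CalabiYau.IsSpecialLagrangianImmersion.im_vol_apply
    (h : Y.IsSpecialLagrangianImmersion f) (p : L)
    (v : Fin (m + 1) → TangentSpace (𝓡∂ (m + 1)) p) :
    ((Y.vol (f p) : E [⋀^Fin (m + 1)]→L[ℂ] ℂ)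
      ((mfderiv (𝓡∂ (m + 1)) 𝓘(ℝ, E) f p).toLinearMap ∘ v)).im = 0 :=
  DFunLike.congr_fun (congrFun h.special p) v

/-- A special Lagrangian immersion is calibrated up to orientation. -/
theorem CalabiYau.IsSpecialLagrangianImmersion.abs_pullback_reForm_apply
    (h : Y.IsSpecialLagrangianImmersion f) (p : L)
    (e : Fin (m + 1) → TangentSpace (𝓡∂ (m + 1)) p)
    (he : ∀ i j, Y.pullbackMetric f p (e i) (e j) = if i = j then 1 else 0) :
    |pullbackForm (𝓡∂ (m + 1)) 𝓘(ℝ, E) f (reForm Y.vol) p e| = 1 :=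
  abs_re_apply_eq_one (V := E) Y.dim_eq (Y.kahler (f p)) (Y.vol (f p)) (Y.invariant_kahler (f p))
    (Y.volume_eq (f p)) (mfderiv (𝓡∂ (m + 1)) 𝓘(ℝ, E) f p).toLinearMap (h.kahler_apply p)
    (h.im_vol_apply p) e he

theorem CalabiYau.IsSpecialLagrangianImmersion.exists_isOrientedFrame
    (h : Y.IsSpecialLagrangianImmersion f) {μ : DForm (𝓡∂ (m + 1)) L ℝ (m + 1)} {p : L}
    (hμ : μ p ≠ 0) : ∃ e, IsOrientedFrame (Y.pullbackMetric f) μ p e :=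
  exists_positive_orthonormal_frame (finrank_tangentSpace_halfSpace p) (pullbackBilin Y f p)
    (pullbackBilin_symm p) (h.pullbackBilin_pos p) (μ p).toAlternatingMap
    fun h0 => hμ (ContinuousAlternatingMap.toAlternatingMap_injective h0)

/-- A special Lagrangian immersion with its calibrated orientation has volume form `f^* Re Ω`. -/
theorem CalabiYau.IsSpecialLagrangianImmersion.volForm_eq
    (h : Y.IsSpecialLagrangianImmersion f) {μ : DForm (𝓡∂ (m + 1)) L ℝ (m + 1)} {p : L}
    (hμ : μ p ≠ 0) {σ : ℝ} (hσ : |σ| = 1)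
    (hpos : ∀ e, 0 < μ p e → 0 < σ * pullbackForm (𝓡∂ (m + 1)) 𝓘(ℝ, E) f (reForm Y.vol) p e) :
    volForm (Y.pullbackMetric f) μ p =
      σ • pullbackForm (𝓡∂ (m + 1)) 𝓘(ℝ, E) f (reForm Y.vol) p := by
  have hf := h.exists_isOrientedFrame hμ
  obtain ⟨b, hb, -, hpb⟩ := exists_basis_eq_orientedFrame (finrank_tangentSpace_halfSpace p)
    (pullbackBilin Y f p) (fun _ _ => rfl) hf
  have h1 := h.abs_pullback_reForm_apply p b (by
    rw [hb]; exact (orientedFrame_spec _ _ hf).1)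
  have h2 : σ * pullbackForm (𝓡∂ (m + 1)) 𝓘(ℝ, E) f (reForm Y.vol) p b = 1 := by
    -- A positive number of absolute value 1 is 1; `σ = ±1` handles both orientations of `L`.
    rw [← abs_of_pos (hpos b hpb), abs_mul, hσ, h1, one_mul]
  have h3 := SLag.volForm_eq (Y.pullbackMetric f) μ b hb hpb.ne'
    (pullbackForm (𝓡∂ (m + 1)) 𝓘(ℝ, E) f (reForm Y.vol) p)
  ext v
  have h4 := DFunLike.congr_fun h3 v
  rw [ContinuousAlternatingMap.smul_apply, smul_eq_mul] at h4 ⊢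
  rw [h4, ← mul_assoc, h2, one_mul]

/-- The pullback of `Re Ω` is `±1` on an orthonormal frame, hence a nonzero multiple of `μ` at the
point. This is what forbids a change of sign along the path. -/
theorem CalabiYau.IsSpecialLagrangianImmersion.pullback_reForm_apply_ne_zero
    (h : Y.IsSpecialLagrangianImmersion f) {μ : DForm (𝓡∂ (m + 1)) L ℝ (m + 1)} {p : L}
    {e : Fin (m + 1) → TangentSpace (𝓡∂ (m + 1)) p} (he : μ p e ≠ 0) :
    pullbackForm (𝓡∂ (m + 1)) 𝓘(ℝ, E) f (reForm Y.vol) p e ≠ 0 := by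
  have hμ : μ p ≠ 0 := fun h0 => he (by rw [h0]; rfl)
  have hf := h.exists_isOrientedFrame hμ
  obtain ⟨b, hb, -, hpb⟩ := exists_basis_eq_orientedFrame (finrank_tangentSpace_halfSpace p)
    (pullbackBilin Y f p) (fun _ _ => rfl) hf
  have h1 := h.abs_pullback_reForm_apply p b (by
    rw [hb]; exact (orientedFrame_spec _ _ hf).1)
  have h3 := DFunLike.congr_fun (SLag.volForm_eq (Y.pullbackMetric f) μ b hb hpb.ne'
    (pullbackForm (𝓡∂ (m + 1)) 𝓘(ℝ, E) f (reForm Y.vol) p)) e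
  rw [h3, ContinuousAlternatingMap.smul_apply, smul_eq_mul]
  refine mul_ne_zero (fun h0 => by rw [h0, abs_zero] at h1; exact zero_ne_one h1) ?_
  rw [volForm, ContinuousAlternatingMap.smul_apply, smul_eq_mul, ← hb]
  exact mul_ne_zero (inv_ne_zero hpb.ne') he

/-- Both forms attached to a path are determined by the normal component of its velocity. -/
theorem exists_normal_component {f : ℝ → L → X} {t : ℝ}
    (h : Y.IsSpecialLagrangianImmersion (f t)) (p : L) : ∃ w : TangentSpace (𝓡∂ (m + 1)) p,
      (∀ v, tangentForm (n := m + 1) f Y.kahler t p v = -pullbackBilin Y (f t) p w (v 0)) ∧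
      ∀ v, tangentForm (n := m + 1) f (imForm Y.vol) t p v =
        pullbackForm (𝓡∂ (m + 1)) 𝓘(ℝ, E) (f t) (reForm Y.vol) p (Fin.cons w v) := by
  obtain ⟨b, hb⟩ := exists_orthonormal_frame (finrank_tangentSpace_halfSpace p)
    (pullbackBilin Y (f t) p) (pullbackBilin_symm p) (h.pullbackBilin_pos p)
  obtain ⟨u, w, hx⟩ := exists_eq_add_I_smul (V := E) Y.dim_eq (Y.kahler (f t p))
    (Y.invariant_kahler (f t p)) (mfderiv (𝓡∂ (m + 1)) 𝓘(ℝ, E) (f t) p).toLinearMap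
    (h.kahler_apply p) b hb (velocity f t p)
  refine ⟨w, fun v => ?_, fun v => ?_⟩
  · have h1 := apply_add_I_smul (V := E) (Y.kahler (f t p)) (Y.invariant_kahler (f t p))
      (mfderiv (𝓡∂ (m + 1)) 𝓘(ℝ, E) (f t) p).toLinearMap (h.kahler_apply p) u w (v 0)
    rw [← hx] at h1
    refine Eq.trans (congrArg (Y.kahler (f t p) : E [⋀^Fin 2]→L[ℝ] ℝ) ?_) h1
    funext j
    fin_cases j <;> rfl
  · have h1 := im_apply_cons_add_I_smul (V := E) (Y.vol (f t p))
      (mfderiv (𝓡∂ (m + 1)) 𝓘(ℝ, E) (f t) p).toLinearMap (h.im_vol_apply p) u w v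
    rw [← hx] at h1
    exact h1

end SpecialLagrangian

/-! ### Constancy of the calibrated orientation -/

section Path

variable {E : Type*} [NormedAddCommGroup E] [NormedSpace ℂ E]
  {X : Type*} [TopologicalSpace X] [ChartedSpace E X] [IsManifold 𝓘(ℂ, E) 1 X]
  [IsManifold 𝓘(ℝ, E) ∞ X]
  {m : ℕ} {L : Type*} [TopologicalSpace L] [ChartedSpace (EuclideanHalfSpace (m + 1)) L]
  [IsManifold (𝓡∂ (m + 1)) ∞ L] {Y : CalabiYau E X (m + 1)} {f : ℝ → L → X}

/-- The calibrated orientation is constant along a path of special Lagrangian immersions. -/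
theorem pullback_reForm_apply_pos
    (hf : ContMDiffOn (𝓘(ℝ, ℝ).prod (𝓡∂ (m + 1))) 𝓘(ℝ, E) ∞ (uncurry f)
      (Icc (0 : ℝ) 1 ×ˢ univ))
    (hsl : ∀ t ∈ Icc (0 : ℝ) 1, Y.IsSpecialLagrangianImmersion (f t))
    {μ : DForm (𝓡∂ (m + 1)) L ℝ (m + 1)}
    (hor : ∀ (p : L) (e : Fin (m + 1) → TangentSpace (𝓡∂ (m + 1)) p), 0 < μ p e →
      0 < pullbackForm (𝓡∂ (m + 1)) 𝓘(ℝ, E) (f 0) (reForm Y.vol) p e)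
    {t : ℝ} (ht : t ∈ Icc (0 : ℝ) 1) (p : L) (e : Fin (m + 1) → TangentSpace (𝓡∂ (m + 1)) p)
    (he : 0 < μ p e) : 0 < pullbackForm (𝓡∂ (m + 1)) 𝓘(ℝ, E) (f t) (reForm Y.vol) p e := by
  have hc := continuousOn_pullbackForm_apply hf (isSmoothForm_reForm Y.holomorphic_vol) p e
  by_contra! hneg
  -- A nonpositive value at `t` and a positive one at `0` would force a zero in between.
  obtain ⟨s, hs, hs0⟩ := isPreconnected_Icc.intermediate_value ht
    (left_mem_Icc.2 zero_le_one) hc ⟨hneg, (hor p e he).le⟩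
  exact (hsl s hs).pullback_reForm_apply_ne_zero he.ne' hs0

end Path

end SLag

end

/-! ### Harmonicity and boundary conditions of the deformation forms -/

open SLag in
theorem mainTheorem1
    {m d : ℕ}
    {E : Type*} [NormedAddCommGroup E] [NormedSpace ℂ E] [FiniteDimensional ℂ E]
    {X : Type*} [TopologicalSpace X] [T2Space X] [SecondCountableTopology X]
    [ChartedSpace E X] [IsManifold 𝓘(ℂ, E) ω X]
    (Y : CalabiYau E X (m + 1))
    {L : Type*} [TopologicalSpace L] [T2Space L] [CompactSpace L]
    [ChartedSpace (EuclideanHalfSpace (m + 1)) L] [IsManifold (𝓡∂ (m + 1)) ∞ L]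
    (C : Fin d → Set L) (hC : IsBoundaryComponents (n := m + 1) C)
    {Λ : Fin d → Type*} [∀ i, TopologicalSpace (Λ i)]
    [∀ i, ChartedSpace (EuclideanSpace ℝ (Fin (m + 1))) (Λ i)]
    [∀ i, IsManifold (𝓡 (m + 1)) ∞ (Λ i)]
    (ι : ∀ i, Λ i → X) (hι : ∀ i, Y.IsEmbeddedLagrangian (ι i))
    (hdisj : Pairwise fun i j => Disjoint (Set.range (ι i)) (Set.range (ι j)))
    (f : ℝ → L → X)
    (hf : ContMDiffOn (𝓘(ℝ, ℝ).prod (𝓡∂ (m + 1))) 𝓘(ℝ, E) ∞ (Function.uncurry f)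
      (Set.Icc (0 : ℝ) 1 ×ˢ Set.univ))
    (hsl : ∀ t ∈ Set.Icc (0 : ℝ) 1, Y.IsSpecialLagrangianImmersion (f t))
    (hbc : ∀ t ∈ Set.Icc (0 : ℝ) 1, HasBoundaryConditions (E := E) (n := m + 1) C ι (f t))
    (μ : DForm (𝓡∂ (m + 1)) L ℝ (m + 1)) (hμ : IsSmoothForm (𝓡∂ (m + 1)) μ)
    (hμ0 : ∀ p, μ p ≠ 0)
    (hor : ∀ (p : L) (e : Fin (m + 1) → TangentSpace (𝓡∂ (m + 1)) p), 0 < μ p e →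
      0 < pullbackForm (𝓡∂ (m + 1)) 𝓘(ℝ, E) (f 0) (reForm Y.vol) p e)
    (t : ℝ) (ht : t ∈ Set.Icc (0 : ℝ) 1)
    (g : ∀ p : L, TangentSpace (𝓡∂ (m + 1)) p → TangentSpace (𝓡∂ (m + 1)) p → ℝ)
    (hg : g = Y.pullbackMetric (f t))
    (θ : DForm (𝓡∂ (m + 1)) L ℝ 1) (hθ : θ = tangentForm f Y.kahler t)
    (φ : DForm (𝓡∂ (m + 1)) L ℝ m) (hφ : φ = tangentForm f (imForm Y.vol) t) :
    (IsSmoothForm (𝓡∂ (m + 1)) θ ∧ dExt (𝓡∂ (m + 1)) θ = 0) ∧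
    (IsSmoothForm (𝓡∂ (m + 1)) φ ∧ dExt (𝓡∂ (m + 1)) φ = 0) ∧
    VanishesOnBoundary θ ∧
    hodgeStar g μ (k := 1) (l := m) rfl θ = -φ ∧
    hodgeStar g (-μ) (k := 1) (l := m) rfl θ = φ ∧
    IsHarmonicField g μ θ ∧ IsDirichlet g θ ∧
    IsHarmonicField g μ φ ∧ IsNeumann g φ := by
  have : IsManifold 𝓘(ℂ, E) 1 X := .of_le (n := ω) le_top
  have : IsManifold 𝓘(ℝ, E) ∞ X := isManifold_real
  have hn := fun p : L => finrank_tangentSpace_halfSpace (m := m) p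
  have h := hsl t ht
  have hpos := fun p => pullback_reForm_apply_pos hf hsl hor ht p
  have hvol : volForm g μ = pullbackForm (𝓡∂ (m + 1)) 𝓘(ℝ, E) (f t) (reForm Y.vol) := by
    funext p
    rw [hg, h.volForm_eq (hμ0 p) (σ := 1) abs_one fun e he => by simpa using hpos p e he, one_smul]
  have hvol' : volForm g (-μ) = -pullbackForm (𝓡∂ (m + 1)) 𝓘(ℝ, E) (f t) (reForm Y.vol) := by
    funext p
    rw [hg, h.volForm_eq (μ := -μ) (neg_ne_zero.2 (hμ0 p)) (σ := -1) (by simp) fun e he => ?_]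
    · exact neg_one_smul ℝ _
    -- Negating the first vector makes a `-μ`-positive frame `μ`-positive.
    · have h1 := hpos p (Fin.cons (-e 0) (Fin.tail e)) (by
        rw [apply_cons_neg, Fin.cons_self_tail]; exact he)
      rw [apply_cons_neg, Fin.cons_self_tail] at h1
      linarith
  have hframe : ∀ p, ∃ e, IsOrientedFrame g μ p e := fun p => by
    rw [hg]; exact h.exists_isOrientedFrame (hμ0 p)
  have hframe' : ∀ p, ∃ e, IsOrientedFrame g (-μ) p e := fun p => by
    rw [hg]; exact h.exists_isOrientedFrame (neg_ne_zero.2 (hμ0 p))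
  have hgG : ∀ p v w, g p v w = pullbackBilin Y (f t) p v w := fun p v w => by rw [hg]; rfl
  choose w hθw hφw using fun p => exists_normal_component h p
  rw [← hθ] at hθw
  rw [← hφ] at hφw
  have hθs : IsSmoothForm (𝓡∂ (m + 1)) θ := hθ ▸ isSmoothForm_tangentForm hf Y.smooth_kahler ht
  have hφs : IsSmoothForm (𝓡∂ (m + 1)) φ :=
    hφ ▸ isSmoothForm_tangentForm hf (isSmoothForm_imForm Y.holomorphic_vol) ht
  have hθd : dExt (𝓡∂ (m + 1)) θ = 0 :=
    hθ ▸ dExt_tangentForm hf Y.smooth_kahler Y.closed_kahler (fun s hs => (hsl s hs).lagrangian) ht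
  have hφd : dExt (𝓡∂ (m + 1)) φ = 0 :=
    hφ ▸ dExt_tangentForm hf (isSmoothForm_imForm Y.holomorphic_vol)
      (dExt_imForm Y.dim_eq Y.holomorphic_vol) (fun s hs => (hsl s hs).special) ht
  have hθb : VanishesOnBoundary θ := hθ ▸ vanishesOnBoundary_tangentForm hC hι hf hsl hbc ht
  have hθn : ∀ p v, θ p v = pullbackBilin Y (f t) p (-w p) (v 0) := fun p v => by
    rw [hθw, map_neg, LinearMap.neg_apply]
  have hstar : hodgeStar g μ (k := 1) (l := m) rfl θ = -φ := by
    funext p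
    ext v
    rw [hodgeStar_apply_of_dual (hn p) _ (hgG p) (hframe p) (hθn p), apply_cons_neg, hvol]
    exact congrArg Neg.neg (hφw p v).symm
  have hstar' : hodgeStar g (-μ) (k := 1) (l := m) rfl θ = φ := by
    funext p
    ext v
    rw [hodgeStar_apply_of_dual (hn p) _ (hgG p) (hframe' p) (hθn p), apply_cons_neg, hvol', hφw]
    exact neg_neg _
  -- `φ` is the contraction of the volume form with `w`, while `θ` is dual to `-w`; hence the extra
  -- minus sign beside the rotation sign.
  have hstarφ : ∀ h1 : 1 + m = m + 1, hodgeStar g μ (k := m) (l := 1) h1 φ =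
      (-((Equiv.Perm.sign (finRotate (m + 1)) : ℤ) : ℝ)) • θ := fun h1 => by
    funext p
    ext v
    rw [hodgeStar_apply_of_contraction (hn p) _ (hgG p) (hframe p) h1
      (fun u => by rw [hφw, hvol])]
    change _ = -((Equiv.Perm.sign (finRotate (m + 1)) : ℤ) : ℝ) * θ p v
    rw [hθw, neg_mul_neg]
  have hθc : IsCoclosed g μ 1 θ := codiff_eq_zero_of_dExt_hodgeStar (k := 0) g μ fun l hl => by
    obtain rfl : l = m := by omega
    rw [hstar, ← neg_one_smul ℝ, dExt_const_smul, hφd, smul_zero]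
  have hφc : IsCoclosed g μ m φ := by
    cases m with
    -- For `n = 1` the form `φ` is a function, on which co-closedness is no condition.
    | zero => trivial
    | succ k =>
      refine codiff_eq_zero_of_dExt_hodgeStar g μ fun l hl => ?_
      obtain rfl : l = 1 := by omega
      rw [hstarφ, dExt_const_smul, hθd, smul_zero]
  refine ⟨⟨hθs, hθd⟩, ⟨hφs, hφd⟩, hθb, hstar, hstar', .of_closed_of_coclosed hθs hθd hθc,
    fun p hp v u hvu => hθb p hp u fun i => (hvu i).1, .of_closed_of_coclosed hφs hφd hφc,
    fun p hp v u hvu => ?_⟩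
  have : IsManifold (𝓡∂ (m + 1)) 1 L := .of_le (n := ∞) (by simp)
  rw [hφw, hφw, sub_eq_zero]
  -- The tangent space of `∂L` is the kernel of coordinate `0`. Vanishing of `θ` there says that `w`
  -- is normal to `∂L`, and each `v i - u i` is normal by definition of the projection.
  refine apply_cons_eq_of_orthogonal (pullbackBilin Y (f t) p) (h.pullbackBilin_pos p)
    (pullbackForm (𝓡∂ (m + 1)) 𝓘(ℝ, E) (f t) (reForm Y.vol) p).toAlternatingMap
    (EuclideanSpace.proj 0 : EuclideanSpace ℝ (Fin (m + 1)) →L[ℝ] ℝ).toLinearMap (w p)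
    (fun x hx => ?_) v u fun i x hx => ?_
  · have h1 := hθb p hp (fun _ => x) fun _ => mem_boundaryTangent_iff.2 hx
    rwa [hθw, neg_eq_zero] at h1
  · rw [← hgG]
    exact (hvu i).2 x (mem_boundaryTangent_iff.2 hx)
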